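/- For a sequence $\mathrm r=\{r_n\}_{n\ge1}$ of positive reals let $\mathsf l_{\mathrm r}$ be the Banach space of complex sequences $\mathsf z=\{z_n\}$ with $\|\mathsf z\|_{\mathrm r}:=\sup_n|z_n|/r_n<\infty$, and let $B^\infty_{\mathrm r}(0,1)$ be its open unit ball. A function $f$ on an open subset $D$ of a complex Banach space is called $\mathrm r$-holomorphic if (i) whenever a closed ball $\bar B(z^0,\beta)$ is contained in $D$, $f$ is bounded on $\bar B(z^0,\beta_1)$ for every $0<\beta_1<\beta$, and (ii) for all $z^0\in D$ and all vectors $z$ the function $t\mapsto f(z^0+tz)$ is holomorphic near $0\in\mathbb C$; it is called holomorphic if it is complex Fréchet differentiable at every point of $D$ (equivalently, if it is locally bounded and satisfies (ii)). A function $u:D\to\mathbb R\cup\{-\infty\}$ is plurisubharmonic if it is upper semicontinuous and its restriction to the intersection of $D$ with each complex line is subharmonic ($\equiv-\infty$ being allowed). A subset $E\subset D$ is plurithick in $D$ if for every sequence $(u_k)$ of plurisubharmonic functions on $D$ that is uniformly bounded from above, $\limsup_k u_k=-\infty$ at every point of $E$ implies $\limsup_k u_k=-\infty$ at every point of $D$.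 **Theorem.** Let $\mathrm r_1,\mathrm r_2$ be sequences of positive reals, and equip $\mathsf l_{\mathrm r_1}\times\mathsf l_{\mathrm r_2}$ with the maximum norm. Let $f$ be $\mathrm r$-holomorphic on $B^\infty_{\mathrm r_1}(0,1)\times B^\infty_{\mathrm r_2}(0,1)$, and suppose that for every $\mathsf z$ in some plurithick subset $E$ of $B^\infty_{\mathrm r_1}(0,1)$ the function $f(\mathsf z,\cdot)$ extends to a holomorphic function on $\mathsf l_{\mathrm r_2}$. Then $f$ extends to a holomorphic function on $B^\infty_{\mathrm r_1}(0,1)\times\mathsf l_{\mathrm r_2}$. -/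

import Mathlib

open Metric Filter

/-- A polyradius: a sequence of positive real numbers. -/
abbrev Polyradius : Type := ℕ → {x : ℝ // 0 < x}

/-- The complex vector space of the complex sequences `z` with `sup_n |z_n| / r_n < ∞`. -/
def seqSubmodule (r : Polyradius) : Submodule ℂ (ℕ → ℂ) where
  carrier := {z | BddAbove (Set.range fun n => ‖z n‖ / (r n : ℝ))}
  zero_mem' := ⟨0, by rintro _ ⟨n, rfl⟩; simp⟩
  add_mem' := by
    rintro z w ⟨a, ha⟩ ⟨b, hb⟩
    refine ⟨a + b, ?_⟩
    rintro _ ⟨n, rfl⟩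
    have h1 : ‖z n‖ / (r n : ℝ) ≤ a := ha ⟨n, rfl⟩
    have h2 : ‖w n‖ / (r n : ℝ) ≤ b := hb ⟨n, rfl⟩
    have h3 : ‖z n + w n‖ / (r n : ℝ) ≤ (‖z n‖ + ‖w n‖) / (r n : ℝ) :=
      div_le_div_of_nonneg_right (norm_add_le _ _) (r n).2.le
    rw [add_div] at h3
    exact h3.trans (add_le_add h1 h2)
  smul_mem' := by
    rintro c z ⟨a, ha⟩
    refine ⟨‖c‖ * a, ?_⟩
    rintro _ ⟨n, rfl⟩
    have h1 : ‖z n‖ / (r n : ℝ) ≤ a := ha ⟨n, rfl⟩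
    have h2 : ‖(c • z) n‖ / (r n : ℝ) = ‖c‖ * (‖z n‖ / (r n : ℝ)) := by
      simp [mul_div_assoc]
    exact h2.le.trans (mul_le_mul_of_nonneg_left h1 (norm_nonneg c))

/-- The sequence space `l_r`. It is a separate type, so that its topology is that of the norm below
and not the topology of pointwise convergence. -/
def SeqSpace (r : Polyradius) : Type := seqSubmodule r

noncomputable section

namespace SeqSpace

variable {r : Polyradius}

instance : AddCommGroup (SeqSpace r) := inferInstanceAs (AddCommGroup (seqSubmodule r))

instance : Module ℂ (SeqSpace r) := inferInstanceAs (Module ℂ (seqSubmodule r))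

/-- The `n`-th coordinate of a sequence. -/
def coord (z : SeqSpace r) (n : ℕ) : ℂ := z.1 n

/-- `‖z‖_r = sup_n |z_n| / r_n`. -/
instance : Norm (SeqSpace r) := ⟨fun z => ⨆ n, ‖z.coord n‖ / (r n : ℝ)⟩

theorem norm_def (z : SeqSpace r) : ‖z‖ = ⨆ n, ‖z.coord n‖ / (r n : ℝ) := rfl

theorem bddAbove (z : SeqSpace r) : BddAbove (Set.range fun n => ‖z.coord n‖ / (r n : ℝ)) := z.2

theorem core : NormedSpace.Core ℂ (SeqSpace r) where
  norm_nonneg z := Real.iSup_nonneg fun n => div_nonneg (norm_nonneg _) (r n).2.le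
  norm_smul c z := by
    have h : ∀ n, ‖(c • z).coord n‖ / (r n : ℝ) = ‖c‖ * (‖z.coord n‖ / (r n : ℝ)) := fun n => by
      have h0 : (c • z).coord n = c * z.coord n := rfl
      rw [h0, norm_mul, mul_div_assoc]
    rw [norm_def, norm_def, Real.mul_iSup_of_nonneg (norm_nonneg c)]
    exact iSup_congr h
  norm_triangle z w := by
    refine ciSup_le fun n => ?_
    have h1 : ‖z.coord n‖ / (r n : ℝ) ≤ ‖z‖ := le_ciSup z.bddAbove n
    have h2 : ‖w.coord n‖ / (r n : ℝ) ≤ ‖w‖ := le_ciSup w.bddAbove n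
    have h3 : ‖(z + w).coord n‖ / (r n : ℝ) ≤ (‖z.coord n‖ + ‖w.coord n‖) / (r n : ℝ) :=
      div_le_div_of_nonneg_right (norm_add_le _ _) (r n).2.le
    rw [add_div] at h3
    exact h3.trans (add_le_add h1 h2)
  norm_eq_zero_iff z := by
    constructor
    · intro h
      refine Subtype.ext (funext fun n => ?_)
      have h1 : ‖z.coord n‖ / (r n : ℝ) ≤ ‖z‖ := le_ciSup z.bddAbove n
      rw [h] at h1
      have h2 : ‖z.coord n‖ ≤ 0 := by
        have := (div_le_iff₀ (r n).2).1 h1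
        simpa using this
      exact norm_le_zero_iff.1 h2
    · rintro rfl
      have h : ∀ n, ‖(0 : SeqSpace r).coord n‖ / (r n : ℝ) = 0 := fun n => by
        have h0 : (0 : SeqSpace r).coord n = 0 := rfl
        simp [h0]
      rw [norm_def]
      simp [h]

instance : NormedAddCommGroup (SeqSpace r) := NormedAddCommGroup.ofCore core

instance : NormedSpace ℂ (SeqSpace r) := NormedSpace.ofCore core

end SeqSpace

end

/-- A function `f` is Gateaux holomorphic on the open set `D`: for all `z₀ ∈ D` and all directions
`z`, the function `t ↦ f (z₀ + t z)` is holomorphic near `0`. -/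
def GateauxHolomorphicOn {X : Type*} [NormedAddCommGroup X] [NormedSpace ℂ X]
    (f : X → ℂ) (D : Set X) : Prop :=
  ∀ z₀ ∈ D, ∀ z : X, AnalyticAt ℂ (fun t : ℂ => f (z₀ + t • z)) 0

/-- A function `f` is bounded on balls of `D`: whenever the closed ball of radius `β` about `z₀`
lies in `D`, `f` is bounded on each smaller concentric closed ball. -/
def BoundedOnBalls {X : Type*} [NormedAddCommGroup X] (f : X → ℂ) (D : Set X) : Prop :=
  ∀ (z₀ : X) (β : ℝ), 0 < β → closedBall z₀ β ⊆ D →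
    ∀ β₁ : ℝ, 0 < β₁ → β₁ < β → ∃ M : ℝ, ∀ z ∈ closedBall z₀ β₁, ‖f z‖ ≤ M

/-- An `r`-holomorphic function on the open set `D`: bounded on balls of `D` and Gateaux
holomorphic on `D`. -/
def RHolomorphicOn {X : Type*} [NormedAddCommGroup X] [NormedSpace ℂ X]
    (f : X → ℂ) (D : Set X) : Prop :=
  BoundedOnBalls f D ∧ GateauxHolomorphicOn f D

/-- A function `u : Ω → ℝ ∪ {-∞}` is subharmonic on the open set `Ω ⊆ ℂ` (the constant `-∞` is
allowed): it is upper semicontinuous and satisfies the local submean inequality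
`u c ≤ (2π)⁻¹ ∫ u (c + ρ e^{iθ}) dθ`. The integral, which may be `-∞`, is the infimum (limit) over
`M` of the integrals of the bounded functions `max u M`. -/
def SubharmonicOn (u : ℂ → EReal) (Ω : Set ℂ) : Prop :=
  (∀ t ∈ Ω, u t < ⊤) ∧ UpperSemicontinuousOn u Ω ∧
    ∀ c ∈ Ω, ∃ ρ₀ : ℝ, 0 < ρ₀ ∧ ∀ ρ : ℝ, 0 < ρ → ρ < ρ₀ → ∀ M : ℝ,
      u c ≤ ((Real.circleAverage (fun t => (max (u t) (M : EReal)).toReal) c ρ : ℝ) : EReal)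

/-- A function `u : D → ℝ ∪ {-∞}` is plurisubharmonic on the open set `D`: it is upper
semicontinuous and its restriction to the intersection of `D` with each complex line is
subharmonic. -/
def PlurisubharmonicOn {X : Type*} [NormedAddCommGroup X] [NormedSpace ℂ X]
    (u : X → EReal) (D : Set X) : Prop :=
  (∀ z ∈ D, u z < ⊤) ∧ UpperSemicontinuousOn u D ∧
    ∀ z₀ ∈ D, ∀ z : X, SubharmonicOn (fun t : ℂ => u (z₀ + t • z)) {t : ℂ | z₀ + t • z ∈ D}

/-- The subset `E` of the open set `D` is plurithick in `D`: for every sequence of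
plurisubharmonic functions on `D` that is uniformly bounded from above, if its upper limit is `-∞`
at all points of `E` then it is `-∞` at all points of `D`. -/
def Plurithick {X : Type*} [NormedAddCommGroup X] [NormedSpace ℂ X] (E D : Set X) : Prop :=
  E ⊆ D ∧ ∀ u : ℕ → X → EReal, (∀ k, PlurisubharmonicOn (u k) D) →
    (∃ C : ℝ, ∀ k, ∀ z ∈ D, u k z ≤ (C : EReal)) →
    (∀ z ∈ E, limsup (fun k => u k z) atTop = ⊥) →
      ∀ z ∈ D, limsup (fun k => u k z) atTop = ⊥

/-!
The theorem holds for arbitrary Banach spaces `X`, `Y` in place of the two sequence spaces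
(`exists_extension_of_plurithick`); of the sequence spaces only the completeness is used.

Expand `f (z, ·)` about `0` into its homogeneous Taylor terms `P n (z, w)` (`partialTaylorTerm`).
They are holomorphic on `ball 0 1 ×ˢ univ`, since a Gateaux holomorphic function which is bounded on
balls is Fréchet differentiable (`differentiableAt_of_gateaux`), and their sum is `f` on the product
of the unit balls. The extension is the sum of this series over all `w`; what must be shown is that
the series converges locally uniformly on `ball 0 1 ×ˢ univ`.

For `z ∈ E` and any `w`, Cauchy's estimates for the entire extension give `|P n (z, w)| ^ (1/n) → 0`.
For fixed `w` the functions `log |P n (·, w)| / n` are plurisubharmonic and tend to `-∞` on `E`. They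
are uniformly bounded above only on smaller balls, whereas plurithickness asks for a bound on the
whole unit ball. Replacing `P n (·, w)` by its Taylor polynomial about `0` of degree `n * a n`, with
`a n → ∞` slowly, repairs this and changes `P n` at each point by a super-geometrically small amount
only. Hence `|P n (z, w)| ^ (1/n) → 0` for all `z` in the unit ball and all `w`
(`Plurithick.superGeometric_ball`).

It remains to pass from pointwise to locally uniform convergence near a point `p`
(`exists_ball_norm_le_geometric`). On each complex line through `p`, Hartogs' lemma
(`Complex.exists_forall_norm_mul_pow_le`), which rests on Jensen's formula and dominated convergence,
gives a uniform bound for `2 ^ n * |P n|`. So for each small direction `h` the Taylor terms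
`T n k h` of `P n` about `p` satisfy `|T n k h| ≤ M / 2 ^ n` with `M` depending on `h`. By Baire's
theorem `M` may be taken uniform on some ball of directions, and by homogeneity and the maximum
principle (`norm_le_of_homogeneous`) this ball may be centred at `0`. Summing over `k` gives a
geometric bound for `P n` near `p`.
-/

open scoped Topology ENNReal

/-! ### Completeness of the sequence spaces -/

/-- The map `x ↦ (r n * x n)` is an isometry of `ℓ^∞` onto `l_r`. -/
instance SeqSpace.instCompleteSpace (r : Polyradius) : CompleteSpace (SeqSpace r) := by
  have hr : ∀ n, (0 : ℝ) < r n := fun n => (r n).2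
  have hmem : ∀ x : lp (fun _ : ℕ => ℂ) ∞, (fun n => (r n : ℂ) * x n) ∈ seqSubmodule r := by
    intro x
    obtain ⟨C, hC⟩ := (memℓp_infty_iff.1 (lp.memℓp x))
    refine ⟨C, ?_⟩
    rintro _ ⟨n, rfl⟩
    have : ‖(r n : ℂ) * x n‖ / (r n : ℝ) = ‖x n‖ := by
      rw [norm_mul, Complex.norm_of_nonneg (hr n).le, mul_div_cancel_left₀ _ (hr n).ne']
    simpa only [this] using hC ⟨n, rfl⟩
  let φ : lp (fun _ : ℕ => ℂ) ∞ → SeqSpace r := fun x => ⟨fun n => (r n : ℂ) * x n, hmem x⟩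
  have hcoord : ∀ x n, (φ x).coord n = (r n : ℂ) * x n := fun x n => rfl
  have hsub : ∀ x y : SeqSpace r, ∀ n, (x - y).coord n = x.coord n - y.coord n :=
    fun x y n => rfl
  have hiso : Isometry φ := by
    refine Isometry.of_dist_eq fun x y => ?_
    rw [dist_eq_norm, dist_eq_norm, SeqSpace.norm_def, lp.norm_eq_ciSup]
    refine iSup_congr fun n => ?_
    rw [hsub, hcoord, hcoord, ← mul_sub, norm_mul, Complex.norm_of_nonneg (hr n).le,
      mul_div_cancel_left₀ _ (hr n).ne']
    rfl
  have hsurj : Function.Surjective φ := by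
    intro z
    have hz : Memℓp (fun n => (r n : ℂ)⁻¹ * z.coord n) ∞ := by
      refine memℓp_infty_iff.2 ?_
      convert z.bddAbove using 3 with n
      rw [norm_mul, norm_inv, Complex.norm_of_nonneg (hr n).le, mul_comm, div_eq_mul_inv]
    refine ⟨⟨_, hz⟩, Subtype.ext (funext fun n => ?_)⟩
    have : (r n : ℂ) ≠ 0 := by exact_mod_cast (hr n).ne'
    change (r n : ℂ) * ((r n : ℂ)⁻¹ * z.coord n) = z.coord n
    rw [mul_inv_cancel_left₀ this]
  have := hiso.isUniformInducing.completeSpace_congr hsurj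
  exact this.1 inferInstance

/-- Second order Cauchy estimate at the centre of a disc. -/
theorem Complex.norm_sub_sub_deriv_le {g : ℂ → ℂ} {R M : ℝ} (hR : 0 < R)
    (hd : DifferentiableOn ℂ g (ball 0 R)) (hM : ∀ t ∈ ball (0 : ℂ) R, ‖g t‖ ≤ M)
    {t : ℂ} (ht : t ∈ ball (0 : ℂ) R) :
    ‖g t - g 0 - t * deriv g 0‖ ≤ 4 * M / R ^ 2 * ‖t‖ ^ 2 := by
  have h0 : (0 : ℂ) ∈ ball (0 : ℂ) R := mem_ball_self hR
  have hM0 : 0 ≤ M := (norm_nonneg _).trans (hM 0 h0)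
  have hmaps : Set.MapsTo g (ball 0 R) (closedBall (g 0) (2 * M)) := by
    intro x hx
    rw [mem_closedBall, dist_eq_norm]
    linarith [norm_sub_le (g x) (g 0), hM x hx, hM 0 h0]
  have hs1 : ∀ x ∈ ball (0 : ℂ) R, ‖dslope g 0 x‖ ≤ 2 * M / R :=
    fun x hx => Complex.norm_dslope_le_div_of_mapsTo_ball hd hmaps hx
  have hd1 : DifferentiableOn ℂ (dslope g 0) (ball 0 R) :=
    (Complex.differentiableOn_dslope (isOpen_ball.mem_nhds h0)).2 hd
  have hmaps1 : Set.MapsTo (dslope g 0) (ball 0 R) (closedBall (dslope g 0 0) (4 * M / R)) := by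
    intro x hx
    rw [mem_closedBall, dist_eq_norm]
    have h1 := norm_sub_le (dslope g 0 x) (dslope g 0 0)
    have h2 := hs1 x hx
    have h3 := hs1 0 h0
    have : 4 * M / R = 2 * M / R + 2 * M / R := by ring
    linarith
  have h2 := Complex.dist_le_div_mul_dist_of_mapsTo_ball hd1 hmaps1 ht
  rw [dist_eq_norm, dist_zero_right, dslope_same] at h2
  have h3 : g t - g 0 - t * deriv g 0 = t * (dslope g 0 t - deriv g 0) := by
    have := sub_smul_dslope g 0 t
    simp only [sub_zero, smul_eq_mul] at this
    rw [mul_sub, this]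
  rw [h3, norm_mul]
  calc ‖t‖ * ‖dslope g 0 t - deriv g 0‖ ≤ ‖t‖ * (4 * M / R / R * ‖t‖) := by gcongr
    _ = _ := by field_simp

/-! ### Gateaux and Fréchet holomorphy, Taylor terms -/

section Holomorphy

variable {E : Type*} [NormedAddCommGroup E] [NormedSpace ℂ E]

theorem differentiableOn_line {g : E → ℂ} {U : Set E}
    (hG : ∀ x ∈ U, ∀ v, DifferentiableAt ℂ (fun t : ℂ => g (x + t • v)) 0)
    {x v : E} {s : Set ℂ} (hs : ∀ t ∈ s, x + t • v ∈ U) :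
    DifferentiableOn ℂ (fun t : ℂ => g (x + t • v)) s := by
  intro t₀ ht₀
  have h1 := hG _ (hs t₀ ht₀) v
  have h2 : DifferentiableAt ℂ (fun t : ℂ => t - t₀) t₀ := by fun_prop
  have h3 : DifferentiableAt ℂ ((fun t : ℂ => g (x + t₀ • v + t • v)) ∘ fun t : ℂ => t - t₀) t₀ :=
    DifferentiableAt.comp t₀ (by simpa using h1) h2
  refine DifferentiableAt.differentiableWithinAt (h3.congr_of_eventuallyEq (.of_forall fun t => ?_))
  simp only [Function.comp]
  congr 1
  module

theorem add_smul_mem_ball {p x v : E} {ρ : ℝ} (hx : x ∈ ball p (ρ / 2)) (hv : v ≠ 0) {t : ℂ}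
    (ht : t ∈ ball (0 : ℂ) (ρ / 2 / ‖v‖)) : x + t • v ∈ ball p ρ := by
  rw [mem_ball_zero_iff, lt_div_iff₀ (norm_pos_iff.2 hv), ← norm_smul] at ht
  rw [mem_ball, dist_eq_norm] at hx ⊢
  calc ‖x + t • v - p‖ = ‖(x - p) + t • v‖ := by congr 1; abel
    _ ≤ ‖x - p‖ + ‖t • v‖ := norm_add_le _ _
    _ < ρ := by linarith

/-- Along each complex line a bounded Gateaux holomorphic function is approximated to second order
by its directional derivative, uniformly in the base point and the direction. -/
theorem norm_sub_sub_deriv_line_le {g : E → ℂ} {p : E} {ρ M : ℝ} (hρ : 0 < ρ)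
    (hb : ∀ x ∈ ball p ρ, ‖g x‖ ≤ M)
    (hG : ∀ x ∈ ball p ρ, ∀ v, DifferentiableAt ℂ (fun t : ℂ => g (x + t • v)) 0)
    {x v : E} (hx : x ∈ ball p (ρ / 2)) (hv : ‖v‖ < ρ / 2) :
    ‖g (x + v) - g x - deriv (fun t : ℂ => g (x + t • v)) 0‖ ≤ 16 * M / ρ ^ 2 * ‖v‖ ^ 2 := by
  rcases eq_or_ne v 0 with rfl | hv0
  · simp
  have hv0' : 0 < ‖v‖ := norm_pos_iff.2 hv0
  set R : ℝ := ρ / 2 / ‖v‖ with hRdef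
  have hR : 0 < R := by positivity
  have hmem : ∀ t ∈ ball (0 : ℂ) R, x + t • v ∈ ball p ρ :=
    fun t ht => add_smul_mem_ball hx hv0 ht
  have h1 : (1 : ℂ) ∈ ball (0 : ℂ) R := by
    rw [mem_ball_zero_iff, norm_one, hRdef, lt_div_iff₀ hv0']
    linarith
  have := Complex.norm_sub_sub_deriv_le hR (differentiableOn_line hG hmem)
    (fun t ht => hb _ (hmem t ht)) h1
  simp only [one_smul, zero_smul, add_zero, one_mul, norm_one, one_pow, mul_one] at this
  refine this.trans (le_of_eq ?_)
  rw [hRdef]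
  field_simp
  ring

/-- A bounded Gateaux holomorphic function on a ball is Lipschitz on the half ball. -/
theorem norm_sub_le_of_gateaux {g : E → ℂ} {p : E} {ρ M : ℝ}
    (hb : ∀ x ∈ ball p ρ, ‖g x‖ ≤ M)
    (hG : ∀ x ∈ ball p ρ, ∀ v, DifferentiableAt ℂ (fun t : ℂ => g (x + t • v)) 0)
    {x v : E} (hx : x ∈ ball p (ρ / 2)) (hv : ‖v‖ < ρ / 2) :
    ‖g (x + v) - g x‖ ≤ 4 * M / ρ * ‖v‖ := by
  rcases eq_or_ne v 0 with rfl | hv0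
  · simp
  have hv0' : 0 < ‖v‖ := norm_pos_iff.2 hv0
  have hρ : 0 < ρ := by linarith
  set R : ℝ := ρ / 2 / ‖v‖ with hRdef
  have hR : 0 < R := by positivity
  have hmem : ∀ t ∈ ball (0 : ℂ) R, x + t • v ∈ ball p ρ :=
    fun t ht => add_smul_mem_ball hx hv0 ht
  have h1 : (1 : ℂ) ∈ ball (0 : ℂ) R := by
    rw [mem_ball_zero_iff, norm_one, hRdef, lt_div_iff₀ hv0']
    linarith
  have hmaps : Set.MapsTo (fun t : ℂ => g (x + t • v)) (ball 0 R)
      (closedBall ((fun t : ℂ => g (x + t • v)) 0) (2 * M)) := by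
    intro t ht
    rw [mem_closedBall, dist_eq_norm]
    have h0 := hb _ (hmem 0 (mem_ball_self hR))
    linarith [norm_sub_le (g (x + t • v)) (g (x + (0 : ℂ) • v)), hb _ (hmem t ht)]
  have := Complex.dist_le_div_mul_dist_of_mapsTo_ball (differentiableOn_line hG hmem) hmaps h1
  simp only [one_smul, zero_smul, add_zero, dist_eq_norm, sub_zero, norm_one, mul_one] at this
  refine this.trans (le_of_eq ?_)
  rw [hRdef]
  field_simp
  ring

/-- Continuity of the directional derivative in the base point. -/
theorem norm_deriv_line_sub_le {g : E → ℂ} {p : E} {ρ M : ℝ} (hρ : 0 < ρ)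
    (hb : ∀ x ∈ ball p ρ, ‖g x‖ ≤ M)
    (hG : ∀ x ∈ ball p ρ, ∀ v, DifferentiableAt ℂ (fun t : ℂ => g (x + t • v)) 0)
    {v k : E} (hv : ‖v‖ < ρ / 4) (hk : ‖k‖ < ρ / 4) :
    ‖deriv (fun t : ℂ => g (p + k + t • v)) 0 - deriv (fun t : ℂ => g (p + t • v)) 0‖ ≤
      4 * M / ρ * ‖k‖ := by
  have hin : ∀ t ∈ closedBall (0 : ℂ) 1, p + t • v ∈ ball p (ρ / 2) := by
    intro t ht
    rw [mem_closedBall_zero_iff] at ht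
    rw [mem_ball, dist_eq_norm, add_sub_cancel_left, norm_smul]
    nlinarith [norm_nonneg v]
  have hin2 : ∀ t ∈ closedBall (0 : ℂ) 1, p + k + t • v ∈ ball p ρ := by
    intro t ht
    have := hin t ht
    rw [mem_ball, dist_eq_norm] at this ⊢
    calc ‖p + k + t • v - p‖ = ‖(p + t • v - p) + k‖ := by congr 1; abel
      _ ≤ ‖p + t • v - p‖ + ‖k‖ := norm_add_le _ _
      _ < ρ := by linarith
  have hd1 := differentiableOn_line hG hin2
  have hd2 := differentiableOn_line hG
    (fun t ht => ball_subset_ball (by linarith) (hin t ht) : ∀ t ∈ closedBall (0 : ℂ) 1, _)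
  have hnh : closedBall (0 : ℂ) 1 ∈ 𝓝 (0 : ℂ) := closedBall_mem_nhds _ one_pos
  rw [← deriv_fun_sub (hd1.differentiableAt hnh) (hd2.differentiableAt hnh)]
  have hdc : DiffContOnCl ℂ (fun t : ℂ => g (p + k + t • v) - g (p + t • v)) (ball 0 1) := by
    refine DifferentiableOn.diffContOnCl ?_
    rw [closure_ball _ one_ne_zero]
    exact hd1.sub hd2
  have := Complex.norm_deriv_le_of_forall_mem_sphere_norm_le (C := 4 * M / ρ * ‖k‖) one_pos hdc ?_
  · simpa using this
  · intro t ht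
    have h1 := norm_sub_le_of_gateaux hb hG (hin t (sphere_subset_closedBall ht))
      (show ‖k‖ < ρ / 2 by linarith)
    rwa [show p + t • v + k = p + k + t • v by abel] at h1

theorem deriv_line_smul (g : E → ℂ) (p v : E) (c : ℂ) :
    deriv (fun t : ℂ => g (p + t • (c • v))) 0 = c * deriv (fun t : ℂ => g (p + t • v)) 0 := by
  have := deriv_comp_mul_left c (fun t : ℂ => g (p + t • v)) 0
  simp only [mul_zero, smul_eq_mul] at this
  rw [← this]
  congr 1
  ext t
  rw [smul_smul, mul_comm]

/-- The directional derivatives of a bounded Gateaux holomorphic function are additive in the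
direction. The increment along `h + k` is the sum of the increments along `k` and, from the shifted
base point, along `h`; the shift is harmless by the continuity of the derivative. -/
theorem deriv_line_add {g : E → ℂ} {p : E} {ρ M : ℝ} (hρ : 0 < ρ)
    (hb : ∀ x ∈ ball p ρ, ‖g x‖ ≤ M)
    (hG : ∀ x ∈ ball p ρ, ∀ v, DifferentiableAt ℂ (fun t : ℂ => g (x + t • v)) 0) (h k : E) :
    deriv (fun t : ℂ => g (p + t • (h + k))) 0 =
      deriv (fun t : ℂ => g (p + t • h)) 0 + deriv (fun t : ℂ => g (p + t • k)) 0 := by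
  have hM : 0 ≤ M := (norm_nonneg _).trans (hb p (mem_ball_self hρ))
  set L : E → E → ℂ := fun x v => deriv (fun t : ℂ => g (x + t • v)) 0 with hL
  have hLs : ∀ x v (c : ℂ), L x (c • v) = c * L x v := fun x v c => deriv_line_smul g x v c
  -- The continuity estimate for the derivative needs a short direction `ε • h`, with `ε` fixed.
  obtain ⟨ε, hε, hεh⟩ : ∃ ε : ℝ, 0 < ε ∧ ε * ‖h‖ < ρ / 4 := by
    refine ⟨ρ / (8 * (‖h‖ + 1)), by positivity, ?_⟩
    rw [div_mul_eq_mul_div, div_lt_iff₀ (by positivity)]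
    nlinarith [norm_nonneg h]
  set C : ℝ := 16 * M / ρ ^ 2 * (‖h + k‖ ^ 2 + ‖h‖ ^ 2 + ‖k‖ ^ 2) + 4 * M / ρ * ‖k‖ / ε with hC
  -- The defect of additivity, tested on the scaled increments `t • h`, `t • k`, is `O(t ^ 2)`.
  have key : ∀ᶠ t : ℝ in 𝓝[>] 0, ‖L p (h + k) - L p h - L p k‖ ≤ C * t := by
    have hsmall : ∀ v : E, ∀ᶠ t : ℝ in 𝓝[>] 0, t * ‖v‖ < ρ / 8 := by
      intro v
      have : Tendsto (fun t : ℝ => t * ‖v‖) (𝓝 0) (𝓝 (0 * ‖v‖)) :=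
        (continuous_id.mul continuous_const).tendsto 0
      rw [zero_mul] at this
      exact nhdsWithin_le_nhds (this.eventually_lt_const (by positivity))
    filter_upwards [hsmall h, hsmall k, hsmall (h + k), self_mem_nhdsWithin] with t h1 h2 h3 ht
    have ht : 0 < t := ht
    have hn : ∀ v : E, ‖(t : ℂ) • v‖ = t * ‖v‖ := fun v => by
      rw [norm_smul, Complex.norm_of_nonneg ht.le]
    have hpk : p + (t : ℂ) • k ∈ ball p (ρ / 2) := by
      rw [mem_ball, dist_eq_norm, add_sub_cancel_left, hn]; linarith
    have hp : p ∈ ball p (ρ / 2) := mem_ball_self (by positivity)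
    have eA := norm_sub_sub_deriv_line_le hρ hb hG (v := (t : ℂ) • (h + k)) hp
      (by rw [hn]; linarith)
    have eB := norm_sub_sub_deriv_line_le hρ hb hG (v := (t : ℂ) • k) hp
      (by rw [hn]; linarith)
    have eC := norm_sub_sub_deriv_line_le hρ hb hG (v := (t : ℂ) • h) hpk
      (by rw [hn]; linarith)
    have eD := norm_deriv_line_sub_le hρ hb hG (v := (ε : ℂ) • h) (k := (t : ℂ) • k)
      (by rw [norm_smul, Complex.norm_of_nonneg hε.le]; exact hεh) (by rw [hn]; linarith)
    rw [hn] at eA eB eC eD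
    change ‖_ - _ - L _ _‖ ≤ _ at eA eB eC
    change ‖L _ _ - L _ _‖ ≤ _ at eD
    rw [hLs] at eA eB eC
    rw [hLs, hLs, ← mul_sub, norm_mul, Complex.norm_of_nonneg hε.le] at eD
    set D := L (p + (t : ℂ) • k) h - L p h with hD
    have eD' : ‖D‖ ≤ 4 * M / ρ * (t * ‖k‖) / ε := by
      rw [le_div_iff₀ hε, mul_comm]; exact eD
    have hid : (t : ℂ) * (L p (h + k) - L p h - L p k) =
        -(g (p + (t : ℂ) • (h + k)) - g p - t * L p (h + k)) +
        (g (p + (t : ℂ) • k) - g p - t * L p k) +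
        (g (p + (t : ℂ) • k + (t : ℂ) • h) - g (p + (t : ℂ) • k) - t * L (p + (t : ℂ) • k) h) +
        t * D := by
      rw [show p + (t : ℂ) • k + (t : ℂ) • h = p + (t : ℂ) • (h + k) by module, hD]
      ring
    have hle : t * ‖L p (h + k) - L p h - L p k‖ ≤ t * (C * t) := by
      calc t * ‖L p (h + k) - L p h - L p k‖
          = ‖(t : ℂ) * (L p (h + k) - L p h - L p k)‖ := by
            rw [norm_mul, Complex.norm_of_nonneg ht.le]
        _ ≤ 16 * M / ρ ^ 2 * (t * ‖h + k‖) ^ 2 + 16 * M / ρ ^ 2 * (t * ‖k‖) ^ 2 +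
            16 * M / ρ ^ 2 * (t * ‖h‖) ^ 2 + t * (4 * M / ρ * (t * ‖k‖) / ε) := by
            rw [hid]
            refine (norm_add_le _ _).trans (add_le_add ((norm_add_le _ _).trans
              (add_le_add ((norm_add_le _ _).trans (add_le_add ?_ eB)) eC)) ?_)
            · rw [norm_neg]; exact eA
            · rw [norm_mul, Complex.norm_of_nonneg ht.le]; gcongr
        _ = t * (C * t) := by rw [hC]; ring
    exact le_of_mul_le_mul_left hle ht
  have hlim : Tendsto (fun t : ℝ => C * t) (𝓝[>] 0) (𝓝 0) := by
    have : Tendsto (fun t : ℝ => C * t) (𝓝 0) (𝓝 (C * 0)) :=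
      (continuous_const.mul continuous_id).tendsto 0
    rw [mul_zero] at this
    exact this.mono_left nhdsWithin_le_nhds
  have h0 := ge_of_tendsto hlim key
  have h1 : L p (h + k) - L p h - L p k = 0 := norm_le_zero_iff.1 h0
  linear_combination h1

/-- A locally bounded Gateaux holomorphic function is Fréchet differentiable. -/
theorem differentiableAt_of_gateaux {g : E → ℂ} {p : E} {ρ M : ℝ} (hρ : 0 < ρ)
    (hb : ∀ x ∈ ball p ρ, ‖g x‖ ≤ M)
    (hG : ∀ x ∈ ball p ρ, ∀ v, DifferentiableAt ℂ (fun t : ℂ => g (x + t • v)) 0) :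
    DifferentiableAt ℂ g p := by
  have hp : p ∈ ball p (ρ / 2) := mem_ball_self (by positivity)
  let L : E →ₗ[ℂ] ℂ :=
    { toFun := fun v => deriv (fun t : ℂ => g (p + t • v)) 0
      map_add' := fun h k => deriv_line_add hρ hb hG h k
      map_smul' := fun c v => deriv_line_smul g p v c }
  have hLv : ∀ v, L v = deriv (fun t : ℂ => g (p + t • v)) 0 := fun v => rfl
  obtain ⟨c, hc, hcρ⟩ : ∃ c : ℝ, 0 < c ∧ c < ρ / 2 := ⟨ρ / 4, by positivity, by linarith⟩
  have hM : 0 ≤ M := (norm_nonneg _).trans (hb p (mem_ball_self hρ))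
  have hsmallL : ∀ v : E, ‖v‖ < c → ‖L v‖ ≤ 2 * M + 16 * M / ρ ^ 2 * c ^ 2 := by
    intro v hv
    have h1 := norm_sub_sub_deriv_line_le hρ hb hG hp (hv.trans hcρ)
    rw [← hLv] at h1
    have h2 : ‖g (p + v)‖ ≤ M := hb _ (by
      rw [mem_ball, dist_eq_norm, add_sub_cancel_left]; linarith)
    have h3 : ‖g p‖ ≤ M := hb _ (mem_ball_self hρ)
    have h4 : 16 * M / ρ ^ 2 * ‖v‖ ^ 2 ≤ 16 * M / ρ ^ 2 * c ^ 2 := by gcongr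
    have h5 : L v = (g (p + v) - g p) - (g (p + v) - g p - L v) := by ring
    rw [h5]
    linarith [norm_sub_le (g (p + v) - g p) (g (p + v) - g p - L v), norm_sub_le (g (p + v)) (g p)]
  obtain ⟨K, hK⟩ : ∃ K : ℝ, ∀ v, ‖L v‖ ≤ K * ‖v‖ := by
    refine L.bound_of_ball_bound hc (2 * M + 16 * M / ρ ^ 2 * c ^ 2) fun v hv => ?_
    exact hsmallL v (by simpa using hv)
  have hder : HasFDerivAt g (L.mkContinuous K hK) p := by
    rw [hasFDerivAt_iff_isLittleO_nhds_zero]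
    refine Asymptotics.IsBigO.trans_isLittleO (g := fun h : E => ‖h‖ ^ 2) ?_ ?_
    · refine Asymptotics.IsBigO.of_bound (16 * M / ρ ^ 2) ?_
      filter_upwards [ball_mem_nhds (0 : E) (show 0 < ρ / 2 by positivity)] with v hv
      have := norm_sub_sub_deriv_line_le hρ hb hG hp (v := v) (by simpa using hv)
      simpa [hLv] using this
    · simpa using (Asymptotics.isLittleO_norm_pow_id (E' := E) one_lt_two)
  exact hder.differentiableAt

theorem exists_bound_ball_of_differentiableOn {g : E → ℂ} {U : Set E} (hU : IsOpen U)
    (hg : DifferentiableOn ℂ g U) {p : E} (hp : p ∈ U) :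
    ∃ ρ > 0, ∃ M : ℝ, ball p ρ ⊆ U ∧ ∀ x ∈ ball p ρ, ‖g x‖ ≤ M := by
  have hc : ContinuousAt g p := (hg.differentiableAt (hU.mem_nhds hp)).continuousAt
  have h1 : ∀ᶠ x in 𝓝 p, ‖g x‖ < ‖g p‖ + 1 :=
    hc.norm.eventually_lt_const (by simp)
  obtain ⟨ρ, hρ, h⟩ := Metric.mem_nhds_iff.1 (inter_mem (hU.mem_nhds hp) h1)
  exact ⟨ρ, hρ, ‖g p‖ + 1, fun x hx => (h hx).1, fun x hx => (h hx).2.le⟩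

theorem DifferentiableOn.gateaux {g : E → ℂ} {U : Set E} (hU : IsOpen U)
    (hg : DifferentiableOn ℂ g U) {x : E} (hx : x ∈ U) (v : E) :
    DifferentiableAt ℂ (fun t : ℂ => g (x + t • v)) 0 := by
  have h1 : DifferentiableAt ℂ g (x + (0 : ℂ) • v) := by
    simpa using hg.differentiableAt (hU.mem_nhds hx)
  exact DifferentiableAt.comp (0 : ℂ) h1 (by fun_prop)

/-- Directional derivatives of a holomorphic function are holomorphic: on small balls they are
uniform limits of difference quotients. -/
theorem differentiableOn_deriv_line {g : E → ℂ} {U : Set E} (hU : IsOpen U)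
    (hg : DifferentiableOn ℂ g U) (v : E) :
    DifferentiableOn ℂ (fun x => deriv (fun t : ℂ => g (x + t • v)) 0) U := by
  intro p hp
  refine DifferentiableAt.differentiableWithinAt ?_
  obtain ⟨ρ, hρ, M, hsub, hM⟩ := exists_bound_ball_of_differentiableOn hU hg hp
  have hG : ∀ x ∈ ball p ρ, ∀ v, DifferentiableAt ℂ (fun t : ℂ => g (x + t • v)) 0 :=
    fun x hx v => hg.gateaux hU (hsub hx) v
  have hM0 : 0 ≤ M := (norm_nonneg _).trans (hM p (mem_ball_self hρ))
  -- By homogeneity the direction may be taken short.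
  obtain ⟨c, hc, hcv⟩ : ∃ c : ℝ, 0 < c ∧ c * ‖v‖ < ρ / 4 := by
    refine ⟨ρ / (8 * (‖v‖ + 1)), by positivity, ?_⟩
    rw [div_mul_eq_mul_div, div_lt_iff₀ (by positivity)]
    nlinarith [norm_nonneg v]
  have hc0 : (c : ℂ) ≠ 0 := by exact_mod_cast hc.ne'
  set w : E := (c : ℂ) • v with hw
  have hwn : ‖w‖ < ρ / 4 := by rwa [hw, norm_smul, Complex.norm_of_nonneg hc.le]
  have hscale : (fun x => deriv (fun t : ℂ => g (x + t • v)) 0) =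
      fun x => (c : ℂ)⁻¹ * deriv (fun t : ℂ => g (x + t • w)) 0 := by
    ext x
    rw [hw, deriv_line_smul, inv_mul_cancel_left₀ hc0]
  rw [hscale]
  refine DifferentiableAt.const_mul ?_ _
  have hhalf : ∀ x ∈ ball p (ρ / 2), ∀ u : E, ‖u‖ < ρ / 2 → x + u ∈ ball p ρ := by
    intro x hx u hu
    rw [mem_ball, dist_eq_norm] at hx ⊢
    rw [show x + u - p = (x - p) + u by abel]
    linarith [norm_add_le (x - p) u]
  refine differentiableAt_of_gateaux (ρ := ρ / 2) (M := 2 * M + 16 * M / ρ ^ 2 * ‖w‖ ^ 2)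
    (by positivity) (fun x hx => ?_) (fun x hx a => ?_)
  · have h1 := norm_sub_sub_deriv_line_le hρ hM hG hx (v := w) (by linarith)
    have h2 := hM _ (hhalf x hx w (by linarith))
    have h3 := hM x (ball_subset_ball (by linarith) hx)
    set d := deriv (fun t : ℂ => g (x + t • w)) 0
    have h5 : d = (g (x + w) - g x) - (g (x + w) - g x - d) := by ring
    rw [h5]
    linarith [norm_sub_le (g (x + w) - g x) (g (x + w) - g x - d), norm_sub_le (g (x + w)) (g x)]
  · set s : Set ℂ := {t : ℂ | x + t • a ∈ ball p (ρ / 2)} with hs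
    have hso : IsOpen s := isOpen_ball.preimage (by fun_prop)
    have h0s : (0 : ℂ) ∈ s := by simpa [hs] using hx
    have hcst : ∀ n : ℕ, ‖((n : ℂ) + 1)‖ = (n : ℝ) + 1 := fun n => by
      rw [← Nat.cast_one, ← Nat.cast_add, Complex.norm_natCast]; push_cast; ring
    have hsm : ∀ n : ℕ, ‖((n : ℂ) + 1)⁻¹ • w‖ = ((n : ℝ) + 1)⁻¹ * ‖w‖ := fun n => by
      rw [norm_smul, norm_inv, hcst]
    have hsm' : ∀ n : ℕ, ‖((n : ℂ) + 1)⁻¹ • w‖ < ρ / 2 := fun n => by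
      rw [hsm]
      have : ((n : ℝ) + 1)⁻¹ ≤ 1 := inv_le_one_of_one_le₀ (by linarith [n.cast_nonneg (α := ℝ)])
      nlinarith [norm_nonneg w]
    let F : ℕ → ℂ → ℂ := fun n t =>
      ((n : ℂ) + 1) * (g (x + t • a + ((n : ℂ) + 1)⁻¹ • w) - g (x + t • a))
    have hF : ∀ n, DifferentiableOn ℂ (F n) s := by
      intro n
      refine DifferentiableOn.const_mul (DifferentiableOn.sub ?_ ?_) _
      · have := differentiableOn_line hG (x := x + ((n : ℂ) + 1)⁻¹ • w) (v := a) (s := s) ?_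
        · refine this.congr fun t _ => ?_
          congr 1
          abel
        · intro t ht
          have := hhalf _ ht _ (hsm' n)
          rwa [show x + ((n : ℂ) + 1)⁻¹ • w + t • a = x + t • a + ((n : ℂ) + 1)⁻¹ • w by abel]
      · exact differentiableOn_line hG fun t ht => ball_subset_ball (by linarith) ht
    have hlim : TendstoUniformlyOn F
        (fun t : ℂ => deriv (fun τ : ℂ => g (x + t • a + τ • w)) 0) atTop s := by
      rw [Metric.tendstoUniformlyOn_iff]
      intro ε hε
      have htend : Tendsto (fun n : ℕ => 16 * M / ρ ^ 2 * ‖w‖ ^ 2 * (1 / ((n : ℝ) + 1))) atTop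
          (𝓝 (16 * M / ρ ^ 2 * ‖w‖ ^ 2 * 0)) :=
        tendsto_one_div_add_atTop_nhds_zero_nat.const_mul _
      rw [mul_zero] at htend
      filter_upwards [htend.eventually_lt_const hε] with n hn t ht
      refine lt_of_le_of_lt ?_ hn
      have h1 := norm_sub_sub_deriv_line_le hρ hM hG ht (hsm' n)
      rw [deriv_line_smul, hsm] at h1
      set d := deriv (fun τ : ℂ => g (x + t • a + τ • w)) 0
      have hne : ((n : ℂ) + 1) ≠ 0 := by exact_mod_cast Nat.succ_ne_zero n
      have hpos : (0 : ℝ) < (n : ℝ) + 1 := by positivity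
      have h2 : F n t - d = ((n : ℂ) + 1) *
          (g (x + t • a + ((n : ℂ) + 1)⁻¹ • w) - g (x + t • a) - ((n : ℂ) + 1)⁻¹ * d) := by
        rw [mul_sub _ _ (_ * d), mul_inv_cancel_left₀ hne]
      rw [dist_comm, dist_eq_norm, h2, norm_mul, hcst]
      calc ((n : ℝ) + 1) * ‖_‖ ≤ ((n : ℝ) + 1) * (16 * M / ρ ^ 2 * (((n : ℝ) + 1)⁻¹ * ‖w‖) ^ 2) := by
            gcongr
        _ = _ := by field_simp
    have := hlim.tendstoLocallyUniformlyOn.differentiableOn (.of_forall hF) hso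
    exact this.differentiableAt (hso.mem_nhds h0s)

end Holomorphy

section Taylor

variable {E : Type*} [NormedAddCommGroup E] [NormedSpace ℂ E]

theorem differentiableOn_iteratedDeriv_snd {G : E × ℂ → ℂ} {W : Set (E × ℂ)} (hW : IsOpen W)
    (hG : DifferentiableOn ℂ G W) (k : ℕ) :
    DifferentiableOn ℂ (fun q : E × ℂ => iteratedDeriv k (fun ζ => G (q.1, ζ)) q.2) W := by
  induction k with
  | zero => simpa using hG
  | succ k ih =>
    refine (differentiableOn_deriv_line hW ih ((0 : E), (1 : ℂ))).congr fun q _ => ?_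
    rw [iteratedDeriv_succ]
    have := deriv_comp_const_add (f := iteratedDeriv k fun ζ => G (q.1, ζ)) q.2 0
    rw [add_zero] at this
    rw [← this]
    simp

/-- The homogeneous part of degree `k` of the Taylor expansion of `φ` about `p`, evaluated at the
increment `h`. -/
noncomputable def taylorTerm (φ : E → ℂ) (p : E) (k : ℕ) (h : E) : ℂ :=
  (k.factorial : ℂ)⁻¹ * iteratedDeriv k (fun ζ : ℂ => φ (p + ζ • h)) 0

/-- Taylor terms are holomorphic jointly in the base point and the increment. -/
theorem differentiableOn_taylorTerm {φ : E → ℂ} {U : Set E} (hU : IsOpen U)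
    (hφ : DifferentiableOn ℂ φ U) (k : ℕ) :
    DifferentiableOn ℂ (fun q : E × E => taylorTerm φ q.1 k q.2) (U ×ˢ Set.univ) := by
  have hW : IsOpen {y : (E × E) × ℂ | y.1.1 + y.2 • y.1.2 ∈ U} := hU.preimage (by fun_prop)
  have h1 : DifferentiableOn ℂ (fun y : (E × E) × ℂ => φ (y.1.1 + y.2 • y.1.2))
      {y : (E × E) × ℂ | y.1.1 + y.2 • y.1.2 ∈ U} :=
    hφ.comp (by fun_prop) fun y hy => hy
  have h2 := differentiableOn_iteratedDeriv_snd hW h1 k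
  refine DifferentiableOn.const_mul ?_ _
  refine h2.comp (f := fun q : E × E => (q, (0 : ℂ))) (by fun_prop) fun q hq => ?_
  simpa using hq.1

theorem differentiable_taylorTerm {φ : E → ℂ} {U : Set E} (hU : IsOpen U)
    (hφ : DifferentiableOn ℂ φ U) {p : E} (hp : p ∈ U) (k : ℕ) :
    Differentiable ℂ (taylorTerm φ p k) := by
  rw [← differentiableOn_univ]
  exact (differentiableOn_taylorTerm hU hφ k).comp (f := fun h : E => (p, h)) (by fun_prop)
    fun h _ => ⟨hp, trivial⟩

theorem taylorTerm_smul (φ : E → ℂ) (p : E) (k : ℕ) (c : ℂ) (h : E) :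
    taylorTerm φ p k (c • h) = c ^ k * taylorTerm φ p k h := by
  have key : ∀ (f : ℂ → ℂ) (k : ℕ) (x : ℂ),
      iteratedDeriv k (fun ζ => f (c * ζ)) x = c ^ k * iteratedDeriv k f (c * x) := by
    intro f k
    induction k with
    | zero => simp
    | succ k ih =>
      intro x
      rw [iteratedDeriv_succ, iteratedDeriv_succ, funext ih, deriv_const_mul_field,
        deriv_comp_mul_left c (iteratedDeriv k f)]
      simp only [smul_eq_mul]
      ring
  have := key (fun ζ => φ (p + ζ • h)) k 0
  rw [mul_zero] at this
  rw [taylorTerm, taylorTerm, mul_left_comm, ← this]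
  simp only [smul_smul, mul_comm]

/-- Cauchy's estimate for the Taylor terms. -/
theorem norm_taylorTerm_le {φ : E → ℂ} {U : Set E}
    (hφ : DifferentiableOn ℂ φ U) {p h : E} {r M : ℝ} (hr : 0 < r)
    (hmem : ∀ ζ : ℂ, ‖ζ‖ ≤ r → p + ζ • h ∈ U) (hM : ∀ ζ : ℂ, ‖ζ‖ ≤ r → ‖φ (p + ζ • h)‖ ≤ M)
    (k : ℕ) : ‖taylorTerm φ p k h‖ ≤ M / r ^ k := by
  have hd : DiffContOnCl ℂ (fun ζ : ℂ => φ (p + ζ • h)) (ball 0 r) := by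
    refine DifferentiableOn.diffContOnCl ?_
    rw [closure_ball _ hr.ne']
    exact hφ.comp (by fun_prop) fun ζ hζ => hmem ζ (by simpa using hζ)
  have := Complex.norm_iteratedDeriv_le_of_forall_mem_sphere_norm_le k hr hd
    (fun ζ hζ => hM ζ (by simpa using (mem_sphere_zero_iff_norm.1 hζ).le))
  rw [taylorTerm, norm_mul, norm_inv, Complex.norm_natCast,
    inv_mul_le_iff₀ (by exact_mod_cast k.factorial_pos)]
  exact this.trans_eq (mul_div_assoc _ _ _)

theorem hasSum_taylorTerm {φ : E → ℂ} {U : Set E}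
    (hφ : DifferentiableOn ℂ φ U) {p h : E} {r : ℝ} (hr : 1 < r)
    (hmem : ∀ ζ : ℂ, ‖ζ‖ < r → p + ζ • h ∈ U) :
    HasSum (fun k => taylorTerm φ p k h) (φ (p + h)) := by
  have hd : DifferentiableOn ℂ (fun ζ : ℂ => φ (p + ζ • h)) (ball 0 r) :=
    hφ.comp (by fun_prop) fun ζ hζ => hmem ζ (by simpa using hζ)
  have := Complex.hasSum_taylorSeries_on_ball hd (z := 1) (by simpa using hr)
  simpa [taylorTerm] using this

end Taylor

/-! ### Hartogs' lemma in one variable -/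

section Hartogs

open MeasureTheory

theorem Complex.integral_polarCoord_eq_circleAverage (v : ℂ → ℝ) (c : ℂ) (s : ℝ) :
    ∫ θ in Set.Ioo (-Real.pi) Real.pi, v (c + Complex.polarCoord.symm (s, θ)) =
      2 * Real.pi * Real.circleAverage v c s := by
  have h1 : ∀ θ : ℝ, c + Complex.polarCoord.symm (s, θ) = circleMap c s θ := fun θ => by
    rw [Complex.polarCoord_symm_apply, circleMap, Complex.exp_mul_I, Complex.ofReal_cos,
      Complex.ofReal_sin]
  have hpi : -Real.pi ≤ Real.pi := by linarith [Real.pi_pos]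
  simp only [h1]
  rw [Real.circleAverage_eq_integral_add (-Real.pi),
    intervalIntegral.integral_comp_add_right (fun θ => v (circleMap c s θ)), smul_eq_mul,
    mul_inv_cancel_left₀ (by positivity), ← integral_Ioc_eq_integral_Ioo,
    ← intervalIntegral.integral_of_le hpi]
  congr 1 <;> ring

/-- The submean inequality over circles implies the submean inequality over discs. -/
theorem Complex.mul_le_integral_ball_of_le_circleAverage {v : ℂ → ℝ} {c : ℂ} {R : ℝ} (hR : 0 < R)
    (hv : ContinuousOn v (closedBall c R))
    (hsub : ∀ s, 0 < s → s < R → v c ≤ Real.circleAverage v c s) :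
    Real.pi * R ^ 2 * v c ≤ ∫ z in ball c R, v z := by
  set f : ℂ → ℝ := (ball (0 : ℂ) R).indicator fun z => v (c + z) with hf
  have h1 : ∫ z in ball c R, v z = ∫ z, f z := by
    rw [← integral_indicator measurableSet_ball,
      ← integral_add_left_eq_self ((ball c R).indicator v) c]
    refine integral_congr_ae (.of_forall fun z => ?_)
    simp only [hf, Set.indicator, mem_ball, dist_eq_norm, add_sub_cancel_left, sub_zero]
  have hcont : ContinuousOn (fun p : ℝ × ℝ => p.1 * v (c + Complex.polarCoord.symm p))
      (Set.Icc 0 R ×ˢ Set.Icc (-Real.pi) Real.pi) := by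
    refine continuousOn_fst.mul (hv.comp ?_ ?_)
    · simp only [Complex.polarCoord_symm_apply]
      fun_prop
    · intro p hp
      rw [mem_closedBall, dist_eq_norm, add_sub_cancel_left, Complex.norm_polarCoord_symm,
        abs_of_nonneg hp.1.1]
      exact hp.1.2
  have hint : IntegrableOn (fun p : ℝ × ℝ => p.1 * v (c + Complex.polarCoord.symm p))
      (Set.Ioo 0 R ×ˢ Set.Ioo (-Real.pi) Real.pi) (volume.prod volume) :=
    (hcont.integrableOn_compact (isCompact_Icc.prod isCompact_Icc)).mono_set
      (Set.prod_mono Set.Ioo_subset_Icc_self Set.Ioo_subset_Icc_self)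
  have h2 : ∫ z, f z =
      ∫ s in Set.Ioo 0 R, s * (2 * Real.pi * Real.circleAverage v c s) := by
    rw [← Complex.integral_comp_polarCoord_symm]
    have h3 : ∫ p in polarCoord.target, p.1 • f (Complex.polarCoord.symm p) =
        ∫ p in Set.Ioo 0 R ×ˢ Set.Ioo (-Real.pi) Real.pi,
          p.1 * v (c + Complex.polarCoord.symm p) := by
      rw [← integral_indicator (measurableSet_Ioo.prod measurableSet_Ioo),
        ← integral_indicator polarCoord.open_target.measurableSet]
      refine integral_congr_ae (.of_forall fun p => ?_)
      simp only [Set.indicator, polarCoord_target, Set.mem_prod, Set.mem_Ioi, hf,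
        mem_ball_zero_iff, Complex.norm_polarCoord_symm, smul_eq_mul, Set.mem_Ioo (b := R)]
      by_cases h0 : 0 < p.1
      · by_cases hp : p.2 ∈ Set.Ioo (-Real.pi) Real.pi <;> by_cases hpR : p.1 < R <;>
          simp [h0, hp, hpR, abs_of_pos h0]
      · simp [h0]
    rw [h3, Measure.volume_eq_prod, setIntegral_prod _ hint]
    refine integral_congr_ae (.of_forall fun s => ?_)
    simp only
    rw [integral_const_mul, Complex.integral_polarCoord_eq_circleAverage]
  have h4 : IntegrableOn (fun s => s * (2 * Real.pi * Real.circleAverage v c s))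
      (Set.Ioo 0 R) := by
    have h6 := hint.integrable
    rw [← Measure.prod_restrict] at h6
    refine h6.integral_prod_left.congr (.of_forall fun s => ?_)
    simp only
    rw [integral_const_mul, Complex.integral_polarCoord_eq_circleAverage]
  have h5 : IntegrableOn (fun s : ℝ => s * (2 * Real.pi * v c)) (Set.Ioo 0 R) :=
    (Continuous.integrableOn_Icc (by fun_prop)).mono_set Set.Ioo_subset_Icc_self
  rw [h1, h2]
  calc Real.pi * R ^ 2 * v c = ∫ s in Set.Ioo 0 R, s * (2 * Real.pi * v c) := by
        rw [← integral_Ioc_eq_integral_Ioo, ← intervalIntegral.integral_of_le hR.le,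
          intervalIntegral.integral_mul_const, integral_id]
        ring
    _ ≤ _ := by
        refine setIntegral_mono_on h5 h4 measurableSet_Ioo fun s hs => ?_
        have := hsub s hs.1 hs.2
        have := hs.1
        have := Real.pi_pos
        gcongr

/-- For holomorphic `q` the function `log (max |q| 1)` is subharmonic. -/
theorem Complex.log_max_norm_one_le_circleAverage {q : ℂ → ℂ} {c : ℂ} {s : ℝ} (hs : 0 < s)
    (hq : AnalyticOnNhd ℂ q (closedBall c s)) :
    Real.log (max ‖q c‖ 1) ≤ Real.circleAverage (fun z => Real.log (max ‖q z‖ 1)) c s := by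
  have hci : CircleIntegrable (fun z => Real.log (max ‖q z‖ 1)) c s := by
    refine ContinuousOn.circleIntegrable hs.le (ContinuousOn.log ?_ fun z _ =>
      (lt_max_of_lt_right one_pos).ne')
    have h1 := (hq.continuousOn.mono sphere_subset_closedBall).norm
    exact h1.sup continuousOn_const
  rcases le_or_gt ‖q c‖ 1 with h | h
  · rw [max_eq_right h, ← Real.circleAverage_const (Real.log 1) c s]
    exact Real.circleAverage_mono (circleIntegrable_const _ _ _) hci
      fun z _ => Real.log_le_log one_pos (le_max_right _ _)
  · rw [max_eq_left h.le]
    have hqc : q c ≠ 0 := norm_pos_iff.1 (one_pos.trans h)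
    have hq' : AnalyticOnNhd ℂ q (closedBall c |s|) := by rwa [abs_of_pos hs]
    have hJ := hq'.circleAverage_log_norm hs.ne' hqc
    have h1 : Real.log ‖q c‖ ≤ Real.circleAverage (Real.log ‖q ·‖) c s := by
      rw [hJ, le_add_iff_nonneg_left]
      refine finsum_nonneg fun u => ?_
      by_cases hu : u ∈ closedBall c |s|
      · refine mul_nonneg ?_ ?_
        · exact_mod_cast (MeromorphicOn.AnalyticOnNhd.divisor_nonneg hq') u
        · rw [abs_of_pos hs, mem_closedBall, dist_comm, dist_eq_norm] at hu
          rcases eq_or_ne u c with rfl | hne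
          · simp
          · have : 0 < ‖c - u‖ := norm_pos_iff.2 (sub_ne_zero.2 hne.symm)
            refine Real.log_nonneg ?_
            rwa [← div_eq_mul_inv, one_le_div this]
      · simp [Function.locallyFinsuppWithin.apply_eq_zero_of_notMem _ hu]
    refine h1.trans (Real.circleAverage_mono ?_ hci fun z hz => ?_)
    · exact (hq'.mono sphere_subset_closedBall).meromorphicOn.circleIntegrable_log_norm
    · -- At a zero of `q` the junk value `log 0 = 0` does no harm, as the right side is nonnegative.
      rcases eq_or_ne (q z) 0 with h0 | h0
      · simp [h0]
      · exact Real.log_le_log (norm_pos_iff.2 h0) (le_max_left _ _)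

/-- For holomorphic `q` and `ε > 0` the function `log (max |q| ε)` is subharmonic. -/
theorem Complex.log_max_norm_le_circleAverage {q : ℂ → ℂ} {c : ℂ} {s ε : ℝ} (hs : 0 < s)
    (hε : 0 < ε) (hq : AnalyticOnNhd ℂ q (closedBall c s)) :
    Real.log (max ‖q c‖ ε) ≤ Real.circleAverage (fun z => Real.log (max ‖q z‖ ε)) c s := by
  have hq' : AnalyticOnNhd ℂ (fun z => (ε : ℂ)⁻¹ * q z) (closedBall c s) :=
    analyticOnNhd_const.mul hq
  have hkey : ∀ z, Real.log (max ‖q z‖ ε) =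
      Real.log ε + Real.log (max ‖(ε : ℂ)⁻¹ * q z‖ 1) := by
    intro z
    rw [← Real.log_mul hε.ne' (lt_max_of_lt_right one_pos).ne', mul_max_of_nonneg _ _ hε.le,
      norm_mul, norm_inv, Complex.norm_of_nonneg hε.le, mul_inv_cancel_left₀ hε.ne', mul_one]
  have hci : CircleIntegrable (fun z => Real.log (max ‖(ε : ℂ)⁻¹ * q z‖ 1)) c s := by
    refine ContinuousOn.circleIntegrable hs.le (ContinuousOn.log ?_ fun z _ =>
      (lt_max_of_lt_right one_pos).ne')
    have h1 := (hq'.continuousOn.mono sphere_subset_closedBall).norm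
    exact h1.sup continuousOn_const
  simp only [hkey]
  rw [Real.circleAverage_fun_add (circleIntegrable_const _ _ _) hci, Real.circleAverage_const]
  exact add_le_add_right (Complex.log_max_norm_one_le_circleAverage hs hq') _

/-- **Hartogs' lemma** for the subharmonic functions `log |q n| / n`: if they are bounded above on a
disc and tend to `-∞` pointwise, they tend to `-∞` uniformly on a smaller disc. -/
theorem Complex.exists_forall_norm_mul_pow_le {q : ℕ → ℂ → ℂ} {C K : ℝ} (hC : 1 ≤ C) (hK : 1 ≤ K)
    (hq : ∀ n, DifferentiableOn ℂ (q n) (ball 0 5))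
    (hbound : ∀ n, ∀ z ∈ ball (0 : ℂ) 5, ‖q n z‖ ≤ C * K ^ n)
    (hpt : ∀ z ∈ ball (0 : ℂ) 5, ∀ R : ℝ, 0 < R → ∃ M : ℝ, ∀ n, ‖q n z‖ * R ^ n ≤ M)
    {R : ℝ} (hR : 0 < R) :
    ∃ M : ℝ, ∀ n, ∀ z ∈ closedBall (0 : ℂ) 1, ‖q n z‖ * R ^ n ≤ M := by
  -- `B` bounds `log |q n| / n` from above. The truncations `v n` of these functions at `-T` tend to
  -- `-T`. The submean inequality over discs of radius 3 about `c`, which contain the disc of radius 2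
  -- about `0`, gives `v n c ≤ B - (4 / 9) * (B + T) + 1` for large `n`; `T` is chosen accordingly.
  set B : ℝ := Real.log C + Real.log K with hB
  have hB0 : 0 ≤ B := add_nonneg (Real.log_nonneg hC) (Real.log_nonneg hK)
  obtain ⟨T, hT0, hT⟩ : ∃ T : ℝ, 0 ≤ T ∧ B - 4 / 9 * (B + T) + 1 ≤ -Real.log R := by
    refine ⟨max 0 (9 / 4 * (B + 1 + Real.log R)), le_max_left _ _, ?_⟩
    linarith [le_max_right 0 (9 / 4 * (B + 1 + Real.log R))]
  let v : ℕ → ℂ → ℝ := fun n z => (n : ℝ)⁻¹ * Real.log (max ‖q n z‖ (Real.exp (-T * n)))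
  have hmaxpos : ∀ n z, 0 < max ‖q n z‖ (Real.exp (-T * n)) :=
    fun n z => lt_max_of_lt_right (Real.exp_pos _)
  have hvcont : ∀ n, ContinuousOn (v n) (ball 0 5) := fun n =>
    continuousOn_const.mul (ContinuousOn.log ((hq n).continuousOn.norm.sup continuousOn_const)
      fun z _ => (hmaxpos n z).ne')
  have hvlow : ∀ n : ℕ, 1 ≤ n → ∀ z, -T ≤ v n z := by
    intro n hn z
    have hn' : (0 : ℝ) < n := by exact_mod_cast hn
    rw [le_inv_mul_iff₀ hn', Real.le_log_iff_exp_le (hmaxpos n z)]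
    exact (by rw [mul_comm] : Real.exp ((n : ℝ) * -T) = Real.exp (-T * n)).trans_le
      (le_max_right _ _)
  have hvup : ∀ n : ℕ, 1 ≤ n → ∀ z ∈ ball (0 : ℂ) 5, v n z ≤ B := by
    intro n hn z hz
    have hn' : (1 : ℝ) ≤ n := by exact_mod_cast hn
    rw [inv_mul_le_iff₀ (by positivity)]
    have hle : max ‖q n z‖ (Real.exp (-T * n)) ≤ C * K ^ n := by
      refine max_le (hbound n z hz) ?_
      calc Real.exp (-T * n) ≤ 1 := Real.exp_le_one_iff.2 (by nlinarith)
        _ ≤ C * K ^ n := one_le_mul_of_one_le_of_one_le hC (one_le_pow₀ hK)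
    refine (Real.log_le_log (hmaxpos n z) hle).trans ?_
    rw [Real.log_mul (by positivity) (by positivity), Real.log_pow, hB]
    nlinarith [Real.log_nonneg hC]
  have hvlim : ∀ z ∈ ball (0 : ℂ) 5, Tendsto (fun n => v n z) atTop (𝓝 (-T)) := by
    intro z hz
    obtain ⟨M, hM⟩ := hpt z hz (Real.exp T) (Real.exp_pos T)
    have hup : Tendsto (fun n : ℕ => -T + Real.log (max M 1) * (n : ℝ)⁻¹) atTop
        (𝓝 (-T + Real.log (max M 1) * 0)) :=
      tendsto_const_nhds.add (tendsto_inv_atTop_nhds_zero_nat.const_mul _)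
    rw [mul_zero, add_zero] at hup
    refine tendsto_of_tendsto_of_tendsto_of_le_of_le' tendsto_const_nhds hup ?_ ?_
    · filter_upwards [eventually_ge_atTop 1] with n hn using hvlow n hn z
    · filter_upwards [eventually_ge_atTop 1] with n hn
      have hn' : (0 : ℝ) < n := by exact_mod_cast hn
      have h1 : max ‖q n z‖ (Real.exp (-T * n)) ≤ max M 1 * Real.exp (-T * n) := by
        have h2 : Real.exp T ^ n * Real.exp (-T * n) = 1 := by
          rw [← Real.exp_nat_mul, ← Real.exp_add, mul_comm (n : ℝ), neg_mul, add_neg_cancel,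
            Real.exp_zero]
        refine max_le ?_ ?_
        · calc ‖q n z‖ = ‖q n z‖ * Real.exp T ^ n * Real.exp (-T * n) := by
                rw [mul_assoc, h2, mul_one]
            _ ≤ max M 1 * Real.exp (-T * n) := by
                gcongr
                exact (hM n).trans (le_max_left _ _)
        · exact le_mul_of_one_le_left (Real.exp_pos _).le (le_max_right _ _)
      rw [inv_mul_le_iff₀ hn']
      refine (Real.log_le_log (hmaxpos n z) h1).trans ?_
      rw [Real.log_mul (by positivity) (Real.exp_pos _).ne', Real.log_exp]
      refine le_of_eq ?_
      field_simp
      ring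
  have hsub2 : closedBall (0 : ℂ) 2 ⊆ ball 0 5 := closedBall_subset_ball (by norm_num)
  have hsub3 : ∀ c ∈ closedBall (0 : ℂ) 1, closedBall c 3 ⊆ ball 0 5 := fun c hc z hz => by
    rw [mem_closedBall_zero_iff] at hc
    rw [mem_closedBall, dist_eq_norm] at hz
    rw [mem_ball_zero_iff]
    calc ‖z‖ = ‖(z - c) + c‖ := by rw [sub_add_cancel]
      _ ≤ ‖z - c‖ + ‖c‖ := norm_add_le _ _
      _ < 5 := by linarith
  have hint : ∀ n, ∀ c r, closedBall c r ⊆ ball (0 : ℂ) 5 → IntegrableOn (v n) (ball c r) :=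
    fun n c r h => (((hvcont n).mono h).integrableOn_compact (isCompact_closedBall c r)).mono_set
      ball_subset_closedBall
  have hvol : ∀ (c : ℂ) (r : ℝ), 0 ≤ r → volume.real (ball c r) = Real.pi * r ^ 2 := by
    intro c r hr
    rw [measureReal_def, Complex.volume_ball]
    simp [ENNReal.toReal_ofReal hr, mul_comm]
  have hintlim : Tendsto (fun n => ∫ z in ball (0 : ℂ) 2, v n z) atTop
      (𝓝 (∫ _ in ball (0 : ℂ) 2, -T)) := by
    refine tendsto_integral_filter_of_dominated_convergence (fun _ => max T B)
      (.of_forall fun n => (hint n 0 2 hsub2).aestronglyMeasurable) ?_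
      (integrableOn_const measure_ball_lt_top.ne) ?_
    · filter_upwards [eventually_ge_atTop 1] with n hn
      refine (ae_restrict_iff' measurableSet_ball).2 (.of_forall fun z hz => ?_)
      rw [Real.norm_eq_abs, abs_le]
      exact ⟨by linarith [hvlow n hn z, le_max_left T B],
        (hvup n hn z (hsub2 (ball_subset_closedBall hz))).trans (le_max_right _ _)⟩
    · exact (ae_restrict_iff' measurableSet_ball).2 (.of_forall fun z hz =>
        hvlim z (hsub2 (ball_subset_closedBall hz)))
  rw [setIntegral_const, hvol _ _ (by norm_num), smul_eq_mul] at hintlim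
  have hpi := Real.pi_pos
  have hev : ∀ᶠ n : ℕ in atTop, ∀ z ∈ closedBall (0 : ℂ) 1, ‖q n z‖ * R ^ n ≤ 1 := by
    filter_upwards [eventually_ge_atTop 1, hintlim.eventually_lt_const
      (show Real.pi * 2 ^ 2 * -T < Real.pi * 2 ^ 2 * -T + 9 * Real.pi by linarith)] with n hn hlt c hc
    have hn' : (0 : ℝ) < n := by exact_mod_cast hn
    have hmean : Real.pi * 3 ^ 2 * v n c ≤ ∫ z in ball c 3, v n z := by
      refine Complex.mul_le_integral_ball_of_le_circleAverage (by norm_num)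
        ((hvcont n).mono (hsub3 c hc)) fun s hs hs3 => ?_
      have han : AnalyticOnNhd ℂ (q n) (closedBall c s) :=
        ((hq n).analyticOnNhd isOpen_ball).mono
          ((closedBall_subset_closedBall hs3.le).trans (hsub3 c hc))
      have h1 := Complex.log_max_norm_le_circleAverage hs (Real.exp_pos (-T * n)) han
      have h2 : Real.circleAverage (v n) c s = (n : ℝ)⁻¹ •
          Real.circleAverage (fun z => Real.log (max ‖q n z‖ (Real.exp (-T * n)))) c s := by
        rw [← Real.circleAverage_fun_smul]
        rfl
      rw [h2, smul_eq_mul]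
      exact mul_le_mul_of_nonneg_left h1 (by positivity)
    have hconst : ∀ (c : ℂ) (r : ℝ), Integrable (fun _ => B) (volume.restrict (ball c r)) :=
      fun c r => integrableOn_const measure_ball_lt_top.ne
    have hcmp : ∫ z in ball (0 : ℂ) 2, (B - v n z) ≤ ∫ z in ball c 3, (B - v n z) := by
      refine setIntegral_mono_set ?_ ?_ ?_
      · exact (hconst c 3).sub (hint n c 3 (hsub3 c hc))
      · exact (ae_restrict_iff' measurableSet_ball).2 (.of_forall fun z hz =>
          sub_nonneg.2 (hvup n hn z (hsub3 c hc (ball_subset_closedBall hz))))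
      · refine LE.le.eventuallyLE fun z hz => ?_
        rw [mem_closedBall_zero_iff] at hc
        rw [mem_ball_zero_iff] at hz
        rw [mem_ball, dist_eq_norm]
        linarith [norm_sub_le z c]
    rw [integral_sub (hconst 0 2) (hint n 0 2 hsub2),
      integral_sub (hconst c 3) (hint n c 3 (hsub3 c hc)),
      setIntegral_const, setIntegral_const, hvol _ _ (by norm_num), hvol _ _ (by norm_num),
      smul_eq_mul, smul_eq_mul] at hcmp
    have hvc : v n c ≤ -Real.log R := by
      refine le_trans ?_ hT
      have h3 : Real.pi * (9 * v n c) ≤ Real.pi * (9 * B - 4 * (B + T) + 9) := by linarith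
      have := le_of_mul_le_mul_left h3 hpi
      linarith
    rw [inv_mul_le_iff₀ hn', Real.log_le_iff_le_exp (hmaxpos n c)] at hvc
    have h4 : ‖q n c‖ ≤ (R ^ n)⁻¹ := by
      refine ((le_max_left _ _).trans hvc).trans_eq ?_
      rw [mul_neg, Real.exp_neg, Real.exp_nat_mul, Real.exp_log hR]
    rwa [← le_div_iff₀ (by positivity), one_div]
  obtain ⟨N, hN⟩ := eventually_atTop.1 hev
  refine ⟨1 + ∑ n ∈ Finset.range N, C * K ^ n * R ^ n, fun n z hz => ?_⟩
  have hnn : ∀ n ∈ Finset.range N, 0 ≤ C * K ^ n * R ^ n := fun n _ => by positivity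
  rcases le_or_gt N n with h | h
  · exact (hN n h z hz).trans (le_add_of_nonneg_right (Finset.sum_nonneg hnn))
  · have h1 := Finset.single_le_sum hnn (Finset.mem_range.2 h)
    have h2 : ‖q n z‖ * R ^ n ≤ C * K ^ n * R ^ n := by
      gcongr
      exact hbound n z (closedBall_subset_ball (by norm_num) hz)
    linarith

end Hartogs

/-! ### Plurithick sets and decay of holomorphic functions -/

section Plurithick

/-- A sequence of nonnegative numbers decays faster than every geometric sequence: its products with
all sequences `R ^ n` are bounded. Equivalently, its `n`-th roots tend to `0`. -/
def SuperGeometric (a : ℕ → ℝ) : Prop :=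
  ∀ R : ℝ, 0 < R → ∃ M : ℝ, ∀ n, a n * R ^ n ≤ M

theorem SuperGeometric.of_eventually {a : ℕ → ℝ}
    (h : ∀ R : ℝ, 0 < R → ∃ M : ℝ, ∀ᶠ n in atTop, a n * R ^ n ≤ M) : SuperGeometric a := by
  intro R hR
  obtain ⟨M, hM⟩ := h R hR
  obtain ⟨M', hM'⟩ := (Filter.isBoundedUnder_of_eventually_le hM).bddAbove_range
  exact ⟨M', fun n => hM' ⟨n, rfl⟩⟩

theorem SuperGeometric.of_le_add {a b c : ℕ → ℝ} (hb : SuperGeometric b) (hc : SuperGeometric c)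
    (h : ∀ n, a n ≤ b n + c n) : SuperGeometric a := by
  intro R hR
  obtain ⟨M, hM⟩ := hb R hR
  obtain ⟨N, hN⟩ := hc R hR
  refine ⟨M + N, fun n => ?_⟩
  calc a n * R ^ n ≤ (b n + c n) * R ^ n := by gcongr; exact h n
    _ = b n * R ^ n + c n * R ^ n := add_mul _ _ _
    _ ≤ M + N := add_le_add (hM n) (hN n)

/-- The function `α * log |Q|` with values in `[-∞, ∞)`, equal to `-∞` at the zeros of `Q`. -/
noncomputable def logNormRpow {X : Type*} (Q : X → ℂ) (α : ℝ) (z : X) : EReal :=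
  ENNReal.log (ENNReal.ofReal (‖Q z‖ ^ α))

/-- The exponent `1 / (n + 1)` in place of `1 / n` avoids the case `n = 0`. -/
theorem limsup_log_rpow_eq_bot_iff {a : ℕ → ℝ} (ha : ∀ n, 0 ≤ a n) :
    limsup (fun n : ℕ => ENNReal.log (ENNReal.ofReal (a n ^ ((n : ℝ) + 1)⁻¹))) atTop = ⊥ ↔
      SuperGeometric a := by
  have hpos : ∀ n : ℕ, (0 : ℝ) < (n : ℝ) + 1 := fun n => by positivity
  have hroot : ∀ (n : ℕ) (ε : ℝ), 0 ≤ ε → (a n ^ ((n : ℝ) + 1)⁻¹ ≤ ε ↔ a n ≤ ε ^ (n + 1)) := by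
    intro n ε hε
    rw [Real.rpow_inv_le_iff_of_pos (ha n) hε (hpos n)]
    norm_cast
  constructor
  · intro h
    refine SuperGeometric.of_eventually fun R hR => ⟨R⁻¹, ?_⟩
    have hlt : limsup (fun n : ℕ => ENNReal.log (ENNReal.ofReal (a n ^ ((n : ℝ) + 1)⁻¹))) atTop <
        ENNReal.log (ENNReal.ofReal R⁻¹) := by
      rw [h, ENNReal.bot_lt_log_iff, ENNReal.ofReal_pos]
      positivity
    filter_upwards [eventually_lt_of_limsup_lt hlt] with n hn
    rw [ENNReal.log_lt_log_iff, ENNReal.ofReal_lt_ofReal_iff (by positivity)] at hn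
    have h1 := (hroot n R⁻¹ (by positivity)).1 hn.le
    calc a n * R ^ n ≤ R⁻¹ ^ (n + 1) * R ^ n := by gcongr
      _ = R⁻¹ := by
        rw [pow_succ, mul_right_comm, ← mul_pow, inv_mul_cancel₀ hR.ne', one_pow, one_mul]
  · intro h
    have hreal : Tendsto (fun n : ℕ => a n ^ ((n : ℝ) + 1)⁻¹) atTop (𝓝 0) := by
      refine tendsto_order.2 ⟨fun x hx => .of_forall fun n =>
        hx.trans_le (Real.rpow_nonneg (ha n) _), fun ε hε => ?_⟩
      obtain ⟨M, hM⟩ := h (4 / ε) (by positivity)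
      have h2 : ∀ᶠ n : ℕ in atTop, M / (ε / 2) ≤ (2 : ℝ) ^ n :=
        (tendsto_pow_atTop_atTop_of_one_lt one_lt_two).eventually_ge_atTop _
      filter_upwards [h2] with n hn
      refine lt_of_le_of_lt ((hroot n (ε / 2) (by positivity)).2 ?_) (half_lt_self hε)
      rw [div_le_iff₀ (by positivity)] at hn
      have h3 : (ε / 2) ^ (n + 1) * (4 / ε) ^ n = 2 ^ n * (ε / 2) := by
        rw [pow_succ, mul_right_comm, ← mul_pow]
        congr 2
        field_simp
        norm_num
      refine le_of_mul_le_mul_right ?_ (show 0 < (4 / ε) ^ n by positivity)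
      rw [h3]
      exact (hM n).trans hn
    have h1 := (ENNReal.continuous_log.tendsto _).comp (ENNReal.tendsto_ofReal hreal)
    rw [ENNReal.ofReal_zero, ENNReal.log_zero] at h1
    exact h1.limsup_eq

theorem subharmonicOn_logNormRpow {q : ℂ → ℂ} {Ω : Set ℂ} (hΩ : IsOpen Ω)
    (hq : DifferentiableOn ℂ q Ω) {α : ℝ} (hα : 0 < α) : SubharmonicOn (logNormRpow q α) Ω := by
  refine ⟨fun t _ => ?_, ?_, fun c hc => ?_⟩
  · rw [logNormRpow, ENNReal.log_lt_top_iff]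
    exact ENNReal.ofReal_lt_top
  · refine ContinuousOn.upperSemicontinuousOn ?_
    refine ENNReal.continuous_log.comp_continuousOn
      (ENNReal.continuous_ofReal.comp_continuousOn ?_)
    exact hq.continuousOn.norm.rpow_const fun _ _ => Or.inr hα.le
  rcases eq_or_ne (q c) 0 with h0 | h0
  · refine ⟨1, one_pos, fun ρ _ _ M => ?_⟩
    simp [logNormRpow, h0, Real.zero_rpow hα.ne']
  -- Away from the zeros, `log |q|` is harmonic, so the local mean value property applies.
  have hcont : ContinuousAt q c := (hq.differentiableAt (hΩ.mem_nhds hc)).continuousAt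
  obtain ⟨ρ₀, hρ₀, hsub⟩ := Metric.mem_nhds_iff.1
    (inter_mem (hΩ.mem_nhds hc) (hcont.eventually_ne h0))
  refine ⟨ρ₀, hρ₀, fun ρ hρ hρlt M => ?_⟩
  have hcb : closedBall c ρ ⊆ ball c ρ₀ := closedBall_subset_ball hρlt
  have hne : ∀ t ∈ closedBall c ρ, q t ≠ 0 := fun t ht => (hsub (hcb ht)).2
  have han : AnalyticOnNhd ℂ q (closedBall c ρ) :=
    (hq.analyticOnNhd hΩ).mono fun t ht => (hsub (hcb ht)).1
  have hval : ∀ t ∈ closedBall c ρ, logNormRpow q α t = ((α * Real.log ‖q t‖ : ℝ) : EReal) := by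
    intro t ht
    have hp : 0 < ‖q t‖ := norm_pos_iff.2 (hne t ht)
    rw [logNormRpow, ENNReal.log_ofReal_of_pos (Real.rpow_pos_of_pos hp _), Real.log_rpow hp]
  have hmean : Real.circleAverage (fun t => α * Real.log ‖q t‖) c ρ = α * Real.log ‖q c‖ := by
    have h1 : Real.circleAverage (Real.log ‖q ·‖) c ρ = Real.log ‖q c‖ := by
      refine AnalyticOnNhd.circleAverage_log_norm_of_ne_zero ?_ ?_ <;> rwa [abs_of_pos hρ]
    rw [← h1, ← smul_eq_mul, ← Real.circleAverage_fun_smul]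
    rfl
  have hlogc : ContinuousOn (fun t => α * Real.log ‖q t‖) (sphere c ρ) :=
    continuousOn_const.mul (ContinuousOn.log
      (han.continuousOn.mono sphere_subset_closedBall).norm fun t ht =>
        (norm_pos_iff.2 (hne t (sphere_subset_closedBall ht))).ne')
  have hcongr : Set.EqOn (fun t => (max (logNormRpow q α t) (M : EReal)).toReal)
      (fun t => max (α * Real.log ‖q t‖) M) (sphere c ρ) := by
    intro t ht
    simp only
    rw [hval t (sphere_subset_closedBall ht), ← EReal.coe_strictMono.monotone.map_max, EReal.toReal_coe]
  rw [hval c (mem_closedBall_self hρ.le), EReal.coe_le_coe_iff, ← hmean,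
    Real.circleAverage_congr_sphere (f₁ := fun t => (max (logNormRpow q α t) (M : EReal)).toReal)
      (by rwa [abs_of_pos hρ])]
  exact Real.circleAverage_mono (hlogc.circleIntegrable hρ.le)
    ((hlogc.sup continuousOn_const).circleIntegrable hρ.le) fun t _ => le_max_left _ _

variable {X : Type*} [NormedAddCommGroup X] [NormedSpace ℂ X]

theorem plurisubharmonicOn_logNormRpow {Q : X → ℂ} {D : Set X} (hD : IsOpen D)
    (hQ : DifferentiableOn ℂ Q D) {α : ℝ} (hα : 0 < α) :
    PlurisubharmonicOn (logNormRpow Q α) D := by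
  refine ⟨fun z _ => ?_, ?_, fun z₀ _ z => ?_⟩
  · rw [logNormRpow, ENNReal.log_lt_top_iff]
    exact ENNReal.ofReal_lt_top
  · refine ContinuousOn.upperSemicontinuousOn ?_
    refine ENNReal.continuous_log.comp_continuousOn
      (ENNReal.continuous_ofReal.comp_continuousOn ?_)
    exact hQ.continuousOn.norm.rpow_const fun _ _ => Or.inr hα.le
  · have hΩ : IsOpen {t : ℂ | z₀ + t • z ∈ D} := hD.preimage (by fun_prop)
    exact subharmonicOn_logNormRpow (q := fun t : ℂ => Q (z₀ + t • z)) hΩ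
      (hQ.comp (by fun_prop) fun t ht => ht) hα

/-- Plurithickness transfers super-geometric decay of a sequence of holomorphic functions of
geometric growth from `E` to `D`. -/
theorem Plurithick.superGeometric {E D : Set X} (hE : Plurithick E D) (hD : IsOpen D)
    {Q : ℕ → X → ℂ} (hQ : ∀ n, DifferentiableOn ℂ (Q n) D) {K : ℝ} (hK : 1 ≤ K)
    (hbound : ∀ n, ∀ z ∈ D, ‖Q n z‖ ≤ K ^ n)
    (hdecay : ∀ z ∈ E, SuperGeometric fun n => ‖Q n z‖) {z : X} (hz : z ∈ D) :
    SuperGeometric fun n => ‖Q n z‖ := by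
  rw [← limsup_log_rpow_eq_bot_iff fun n => norm_nonneg _]
  refine hE.2 (fun n => logNormRpow (Q n) ((n : ℝ) + 1)⁻¹)
    (fun n => plurisubharmonicOn_logNormRpow hD (hQ n) (by positivity))
    ⟨Real.log K, fun n z hz => ?_⟩ (fun z hz => ?_) z hz
  · have h1 : ‖Q n z‖ ^ ((n : ℝ) + 1)⁻¹ ≤ K := by
      rw [Real.rpow_inv_le_iff_of_pos (norm_nonneg _) (by positivity) (by positivity)]
      refine (hbound n z hz).trans ?_
      calc K ^ n ≤ K ^ (n + 1) := pow_le_pow_right₀ hK n.le_succ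
        _ = K ^ ((n : ℝ) + 1) := by norm_cast
    rw [logNormRpow, ← ENNReal.log_ofReal_of_pos (by positivity)]
    exact ENNReal.log_le_log (ENNReal.ofReal_le_ofReal h1)
  · exact (limsup_log_rpow_eq_bot_iff fun n => norm_nonneg _).2 (hdecay z hz)

/-- Truncation degrees for the Taylor expansions of a sequence of functions on the unit ball: given
bounds `C s * A ^ n` on the balls of radius `s < 1`, the degree `n * a n` with `a n → ∞` is still
small enough for the truncations to be bounded geometrically on the whole unit ball. Here `a n` is
the largest `j ≤ n` for which the bound on the ball of radius `(j + 1) / (j + 2)` is at most `2 ^ n`,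
or `0` if there is none. -/
noncomputable def truncationSlope (C : ℝ → ℝ) (n : ℕ) : ℕ :=
  open scoped Classical in Nat.findGreatest (fun j => C (((j : ℝ) + 1) / (j + 2)) ≤ 2 ^ n) n

theorem tendsto_truncationSlope (C : ℝ → ℝ) : Tendsto (truncationSlope C) atTop atTop := by
  classical
  refine tendsto_atTop.2 fun j => ?_
  have h1 : ∀ᶠ n : ℕ in atTop, C (((j : ℝ) + 1) / (j + 2)) ≤ (2 : ℝ) ^ n :=
    (tendsto_pow_atTop_atTop_of_one_lt one_lt_two).eventually_ge_atTop _
  filter_upwards [h1, eventually_ge_atTop j] with n hn hj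
  unfold truncationSlope
  convert Nat.le_findGreatest (P := fun j : ℕ => C (((j : ℝ) + 1) / (j + 2)) ≤ 2 ^ n) hj hn

theorem truncationSlope_le (C : ℝ → ℝ) (n : ℕ) : truncationSlope C n ≤ n := by
  classical
  exact Nat.findGreatest_le n

theorem apply_truncationSlope_le {C : ℝ → ℝ} {n : ℕ} (h : truncationSlope C n ≠ 0) :
    C (((truncationSlope C n : ℝ) + 1) / (truncationSlope C n + 2)) ≤ 2 ^ n := by
  classical
  exact Nat.findGreatest_of_ne_zero (P := fun j : ℕ => C (((j : ℝ) + 1) / (j + 2)) ≤ 2 ^ n) rfl h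

theorem inv_radius_pow_le (j : ℕ) : ((((j : ℝ) + 1) / (j + 2))⁻¹) ^ j ≤ 3 := by
  have h1 : (((j : ℝ) + 1) / (j + 2))⁻¹ ≤ Real.exp (1 / ((j : ℝ) + 1)) := by
    refine le_trans (le_of_eq ?_) (Real.add_one_le_exp _)
    field_simp
    ring
  calc ((((j : ℝ) + 1) / (j + 2))⁻¹) ^ j ≤ Real.exp (1 / ((j : ℝ) + 1)) ^ j := by gcongr
    _ = Real.exp (j * (1 / ((j : ℝ) + 1))) := by rw [Real.exp_nat_mul]
    _ ≤ Real.exp 1 := by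
      refine Real.exp_le_exp.2 ?_
      rw [mul_one_div, div_le_one (by positivity)]
      linarith
    _ ≤ 3 := by linarith [Real.exp_one_lt_d9]

section Truncation

variable {φ : ℕ → X → ℂ} {C : ℝ → ℝ} {A : ℝ}

/-- The truncated Taylor expansions about `0` grow geometrically, uniformly on the unit ball. -/
theorem norm_sum_taylorTerm_le (hφ : ∀ n, DifferentiableOn ℂ (φ n) (ball 0 1)) (hA : 0 ≤ A)
    (hC : ∀ s : ℝ, 1 / 2 ≤ s → s < 1 → ∀ n, ∀ z ∈ closedBall (0 : X) s, ‖φ n z‖ ≤ C s * A ^ n)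
    (n : ℕ) {z : X} (hz : z ∈ ball (0 : X) 1) :
    ‖∑ m ∈ Finset.range (n * truncationSlope C n), taylorTerm (φ n) 0 m z‖ ≤ (24 * A) ^ n := by
  set a := truncationSlope C n with ha
  rcases eq_or_ne a 0 with h0 | h0
  · simp only [h0, mul_zero, Finset.range_zero, Finset.sum_empty, norm_zero]
    positivity
  set s : ℝ := ((a : ℝ) + 1) / (a + 2) with hs
  have hs0 : 0 < s := by positivity
  have hs1 : s < 1 := by rw [hs, div_lt_one (by positivity)]; linarith
  have hs2 : 1 / 2 ≤ s := by
    rw [hs, div_le_div_iff₀ (by positivity) (by positivity)]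
    linarith [a.cast_nonneg (α := ℝ)]
  rw [mem_ball_zero_iff] at hz
  have hin : ∀ ζ : ℂ, ‖ζ‖ ≤ s → 0 + ζ • z ∈ closedBall (0 : X) s := by
    intro ζ hζ
    rw [zero_add, mem_closedBall_zero_iff, norm_smul]
    nlinarith [norm_nonneg z, norm_nonneg ζ]
  have hterm : ∀ m ∈ Finset.range (n * a),
      ‖taylorTerm (φ n) 0 m z‖ ≤ 2 ^ n * A ^ n * 3 ^ n := by
    intro m hm
    have h1 := norm_taylorTerm_le (hφ n) hs0
      (fun ζ hζ => closedBall_subset_ball hs1 (hin ζ hζ))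
      (fun ζ hζ => hC s hs2 hs1 n _ (hin ζ hζ)) m
    have h2 : C s ≤ 2 ^ n := apply_truncationSlope_le h0
    have h3 : (s⁻¹) ^ m ≤ 3 ^ n := by
      calc (s⁻¹) ^ m ≤ (s⁻¹) ^ (a * n) :=
            pow_le_pow_right₀ ((one_le_inv₀ hs0).2 hs1.le)
              (by rw [mul_comm]; exact (Finset.mem_range.1 hm).le)
        _ = ((s⁻¹) ^ a) ^ n := pow_mul _ _ _
        _ ≤ 3 ^ n := by gcongr; exact inv_radius_pow_le a
    calc ‖taylorTerm (φ n) 0 m z‖ ≤ C s * A ^ n * (s⁻¹) ^ m := by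
          rw [inv_pow, ← div_eq_mul_inv]; exact h1
      _ ≤ 2 ^ n * A ^ n * 3 ^ n := by gcongr
  have hcard : ((n * a : ℕ) : ℝ) ≤ 4 ^ n := by
    have h1 : a ≤ n := truncationSlope_le C n
    have h2 : n * a ≤ 4 ^ n := by
      calc n * a ≤ 2 ^ n * 2 ^ n :=
            Nat.mul_le_mul n.lt_two_pow_self.le (h1.trans n.lt_two_pow_self.le)
        _ = 4 ^ n := by rw [← mul_pow]; norm_num
    exact_mod_cast h2
  refine (norm_sum_le_of_le _ hterm).trans ?_
  rw [Finset.sum_const, Finset.card_range, nsmul_eq_mul]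
  calc ((n * a : ℕ) : ℝ) * (2 ^ n * A ^ n * 3 ^ n) ≤ 4 ^ n * (2 ^ n * A ^ n * 3 ^ n) := by gcongr
    _ = (24 * A) ^ n := by
      rw [← mul_pow, ← mul_pow, ← mul_pow]
      congr 1
      ring

/-- The truncation error decays super-geometrically at each point, as the truncation degree divided
by `n` tends to infinity. -/
theorem superGeometric_sub_sum_taylorTerm (hφ : ∀ n, DifferentiableOn ℂ (φ n) (ball 0 1))
    (hA : 0 ≤ A)
    (hC : ∀ s : ℝ, 1 / 2 ≤ s → s < 1 → ∀ n, ∀ z ∈ closedBall (0 : X) s, ‖φ n z‖ ≤ C s * A ^ n)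
    {z : X} (hz : z ∈ ball (0 : X) 1) :
    SuperGeometric fun n =>
      ‖φ n z - ∑ m ∈ Finset.range (n * truncationSlope C n), taylorTerm (φ n) 0 m z‖ := by
  rw [mem_ball_zero_iff] at hz
  have hz0 := norm_nonneg z
  set s : ℝ := (1 + ‖z‖) / 2 with hs
  have hs1 : s < 1 := by linarith
  have hs2 : 1 / 2 ≤ s := by linarith
  -- On `|ζ| ≤ r = s⁻¹` the point `ζ • z` stays in the ball of radius `s`, so Cauchy's estimates make
  -- the Taylor terms decay like `s ^ m`.
  set r : ℝ := s⁻¹ with hr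
  have hs0 : 0 < s := by linarith
  have hr1 : 1 < r := (one_lt_inv₀ hs0).2 hs1
  have hrz : r * ‖z‖ ≤ s := by
    rw [hr, inv_mul_le_iff₀ hs0]
    nlinarith [sq_nonneg (1 - ‖z‖)]
  have hin : ∀ ζ : ℂ, ‖ζ‖ ≤ r → 0 + ζ • z ∈ closedBall (0 : X) s := by
    intro ζ hζ
    rw [zero_add, mem_closedBall_zero_iff, norm_smul]
    exact (mul_le_mul_of_nonneg_right hζ hz0).trans hrz
  have hin' : ∀ ζ : ℂ, ‖ζ‖ ≤ r → 0 + ζ • z ∈ ball (0 : X) 1 :=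
    fun ζ hζ => closedBall_subset_ball hs1 (hin ζ hζ)
  have hCs : 0 ≤ C s := by
    have := (norm_nonneg _).trans (hC s hs2 hs1 0 0 (mem_closedBall_self hs0.le))
    simpa using this
  have hterm : ∀ n m, ‖taylorTerm (φ n) 0 m z‖ ≤ C s * A ^ n * s ^ m := by
    intro n m
    have h1 := norm_taylorTerm_le (hφ n) (by linarith) hin'
      (fun ζ hζ => hC s hs2 hs1 n _ (hin ζ hζ)) m
    rwa [div_eq_mul_inv, ← inv_pow, hr, inv_inv] at h1
  have herr : ∀ n N, ‖φ n z - ∑ m ∈ Finset.range N, taylorTerm (φ n) 0 m z‖ ≤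
      C s * A ^ n * s ^ N * (1 - s)⁻¹ := by
    intro n N
    have hsum : HasSum (fun m => taylorTerm (φ n) 0 m z) (φ n z) := by
      have := hasSum_taylorTerm (hφ n) hr1 fun ζ hζ => hin' ζ hζ.le
      rwa [zero_add] at this
    have htail := (hasSum_nat_add_iff' N).2 hsum
    have hgeo : HasSum (fun m => C s * A ^ n * s ^ N * s ^ m) (C s * A ^ n * s ^ N * (1 - s)⁻¹) :=
      (hasSum_geometric_of_lt_one hs0.le hs1).mul_left _
    rw [← htail.tsum_eq]
    refine tsum_of_norm_bounded hgeo fun m => ?_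
    refine (hterm n (m + N)).trans_eq ?_
    rw [pow_add]
    ring
  refine SuperGeometric.of_eventually fun R hR => ⟨C s * (1 - s)⁻¹, ?_⟩
  have hlim : Tendsto (fun n => A * R * s ^ truncationSlope C n) atTop (𝓝 (A * R * 0)) :=
    ((tendsto_pow_atTop_nhds_zero_of_lt_one hs0.le hs1).comp
      (tendsto_truncationSlope C)).const_mul _
  rw [mul_zero] at hlim
  filter_upwards [hlim.eventually_lt_const one_pos] with n hn
  have hpos : 0 ≤ C s * (1 - s)⁻¹ := mul_nonneg hCs (inv_nonneg.2 (by linarith))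
  calc _ ≤ C s * A ^ n * s ^ (n * truncationSlope C n) * (1 - s)⁻¹ * R ^ n := by
        gcongr; exact herr n _
    _ = C s * (1 - s)⁻¹ * (A * R * s ^ truncationSlope C n) ^ n := by
        rw [mul_pow, mul_pow, ← pow_mul, mul_comm n]; ring
    _ ≤ C s * (1 - s)⁻¹ * 1 := by
        gcongr
        exact pow_le_one₀ (by positivity) hn.le
    _ = _ := mul_one _

/-- Plurithickness in the unit ball transfers super-geometric decay even if the geometric growth is
uniform on the smaller concentric balls only. The definition of plurithickness requires a uniform
upper bound on the whole ball; truncating the Taylor expansions about `0` provides one. -/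
theorem Plurithick.superGeometric_ball {E : Set X} (hE : Plurithick E (ball 0 1))
    (hφ : ∀ n, DifferentiableOn ℂ (φ n) (ball 0 1)) (hA : 1 ≤ A)
    (hC : ∀ s : ℝ, 1 / 2 ≤ s → s < 1 → ∀ n, ∀ z ∈ closedBall (0 : X) s, ‖φ n z‖ ≤ C s * A ^ n)
    (hdecay : ∀ z ∈ E, SuperGeometric fun n => ‖φ n z‖) {z : X} (hz : z ∈ ball (0 : X) 1) :
    SuperGeometric fun n => ‖φ n z‖ := by
  have hA0 : 0 ≤ A := zero_le_one.trans hA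
  have hdiff := fun {z : X} (hz : z ∈ ball (0 : X) 1) =>
    superGeometric_sub_sum_taylorTerm hφ hA0 hC hz
  let Q : ℕ → X → ℂ := fun n z =>
    ∑ m ∈ Finset.range (n * truncationSlope C n), taylorTerm (φ n) 0 m z
  have hQd : ∀ n, DifferentiableOn ℂ (Q n) (ball 0 1) := fun n =>
    DifferentiableOn.fun_sum fun m _ =>
      (differentiable_taylorTerm isOpen_ball (hφ n) (mem_ball_self one_pos) m).differentiableOn
  have hQ := hE.superGeometric isOpen_ball hQd (K := 24 * A) (by linarith)
    (fun n z hz => norm_sum_taylorTerm_le hφ hA0 hC n hz)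
    (fun z hz => (hdecay z hz).of_le_add (hdiff (hE.1 hz)) fun n => by
      simpa using norm_sub_le (φ n z) (φ n z - Q n z)) hz
  exact hQ.of_le_add (hdiff hz) fun n => by
    simpa using norm_add_le (Q n z) (φ n z - Q n z)

end Truncation

end Plurithick

/-! ### Convergence of the Taylor series and extension -/

section Series

variable {Z : Type*} [NormedAddCommGroup Z] [NormedSpace ℂ Z]

/-- A bound for a homogeneous holomorphic function on a ball about any point is also a bound on the
ball of the same radius about the origin. -/
theorem norm_le_of_homogeneous {T : Z → ℂ} (hT : Differentiable ℂ T) {k : ℕ}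
    (hhom : ∀ (c : ℂ) h, T (c • h) = c ^ k * T h) {h₁ : Z} {ρ M : ℝ}
    (hM : ∀ h ∈ ball h₁ ρ, ‖T h‖ ≤ M) {h : Z} (hh : h ∈ ball (0 : Z) ρ) : ‖T h‖ ≤ M := by
  have hd : Differentiable ℂ fun ζ : ℂ => T (ζ • h₁ + h) := hT.comp (by fun_prop)
  have hmax := Complex.norm_le_of_forall_mem_frontier_norm_le (U := ball (0 : ℂ) 1) (C := M)
    isBounded_ball hd.diffContOnCl (fun ζ hζ => ?_) (subset_closure (mem_ball_self one_pos))
  · simpa using hmax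
  -- For `|ζ| = 1`, homogeneity moves the argument into the ball about `h₁`.
  · rw [frontier_ball _ one_ne_zero, mem_sphere_zero_iff_norm] at hζ
    have hζ0 : ζ ≠ 0 := norm_pos_iff.1 (by rw [hζ]; exact one_pos)
    have h1 : ζ • h₁ + h = ζ • (h₁ + ζ⁻¹ • h) := by
      rw [smul_add, smul_inv_smul₀ hζ0]
    rw [h1, hhom, norm_mul, norm_pow, hζ, one_pow, one_mul]
    refine hM _ ?_
    rw [mem_ball, dist_eq_norm, add_sub_cancel_left, norm_smul, norm_inv, hζ, inv_one, one_mul]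
    simpa using hh

/-- A sequence of holomorphic functions of geometric growth which decays super-geometrically at each
point of a ball of a Banach space decays geometrically, uniformly on a smaller concentric ball.
Hartogs' lemma makes the decay uniform on each complex line through the centre, hence for all Taylor
terms at once; Baire's theorem and homogeneity make the latter uniform in the direction. -/
theorem exists_ball_norm_le_geometric [CompleteSpace Z] {P : ℕ → Z → ℂ} {p : Z} {ρ₀ C K : ℝ}
    (hρ₀ : 0 < ρ₀) (hC : 1 ≤ C) (hK : 1 ≤ K) (hP : ∀ n, DifferentiableOn ℂ (P n) (ball p ρ₀))
    (hbound : ∀ n, ∀ x ∈ ball p ρ₀, ‖P n x‖ ≤ C * K ^ n)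
    (hdecay : ∀ x ∈ ball p ρ₀, SuperGeometric fun n => ‖P n x‖) :
    ∃ ρ > 0, ρ ≤ ρ₀ ∧ ∃ M : ℝ, ∀ n, ∀ x ∈ ball p ρ, ‖P n x‖ ≤ M * (1 / 2) ^ n := by
  set r : ℝ := ρ₀ / 5 with hr
  have hr0 : 0 < r := by positivity
  have hline : ∀ h ∈ ball (0 : Z) r, ∀ ζ ∈ ball (0 : ℂ) 5, p + ζ • h ∈ ball p ρ₀ := by
    intro h hh ζ hζ
    rw [mem_ball_zero_iff] at hh hζ
    rw [mem_ball, dist_eq_norm, add_sub_cancel_left, norm_smul]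
    nlinarith [norm_nonneg h, norm_nonneg ζ]
  have hterm : ∀ h ∈ ball (0 : Z) r, ∃ M : ℝ, ∀ n k, ‖taylorTerm (P n) p k h‖ * 2 ^ n ≤ M := by
    intro h hh
    obtain ⟨M, hM⟩ := Complex.exists_forall_norm_mul_pow_le (q := fun n ζ => P n (p + ζ • h)) hC hK
      (fun n => (hP n).comp (by fun_prop) (hline h hh))
      (fun n ζ hζ => hbound n _ (hline h hh ζ hζ))
      (fun ζ hζ => hdecay _ (hline h hh ζ hζ)) two_pos
    refine ⟨M, fun n k => ?_⟩
    have h1 := norm_taylorTerm_le (hP n) (p := p) (h := h) (M := M / 2 ^ n) one_pos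
      (fun ζ hζ => hline h hh ζ (by rw [mem_ball_zero_iff]; linarith))
      (fun ζ hζ => by
        rw [le_div_iff₀ (by positivity)]
        exact hM n ζ (by simpa using hζ)) k
    rwa [one_pow, div_one, le_div_iff₀ (by positivity)] at h1
  have hTd : ∀ n k, Differentiable ℂ (taylorTerm (P n) p k) := fun n k =>
    differentiable_taylorTerm isOpen_ball (hP n) (mem_ball_self hρ₀) k
  -- The complement of the ball is added so that the closed sets `S m` cover the whole space.
  let S : ℕ → Set Z := fun m =>
    {h | ∀ n k, ‖taylorTerm (P n) p k h‖ * 2 ^ n ≤ m} ∪ (ball 0 r)ᶜ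
  have hSc : ∀ m, IsClosed (S m) := by
    intro m
    refine IsClosed.union ?_ isOpen_ball.isClosed_compl
    simp only [Set.ofPred_forall]
    exact isClosed_iInter fun n => isClosed_iInter fun k =>
      isClosed_le ((hTd n k).continuous.norm.mul continuous_const) continuous_const
  have hSu : ⋃ m, S m = Set.univ := by
    refine Set.eq_univ_of_forall fun h => Set.mem_iUnion.2 ?_
    by_cases hh : h ∈ ball (0 : Z) r
    · obtain ⟨M, hM⟩ := hterm h hh
      obtain ⟨m, hm⟩ := exists_nat_ge M
      exact ⟨m, Or.inl fun n k => (hM n k).trans hm⟩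
    · exact ⟨0, Or.inr hh⟩
  obtain ⟨h₁, hh₁, hh₁S⟩ := (dense_iUnion_interior_of_closed hSc hSu).inter_open_nonempty
    (ball 0 r) isOpen_ball ⟨0, mem_ball_self hr0⟩
  obtain ⟨m, hm⟩ := Set.mem_iUnion.1 hh₁S
  obtain ⟨ρ, hρ, hsub⟩ := Metric.mem_nhds_iff.1
    (inter_mem (isOpen_ball.mem_nhds hh₁) (mem_interior_iff_mem_nhds.1 hm))
  have hT : ∀ n k, ∀ h ∈ ball (0 : Z) ρ, ‖taylorTerm (P n) p k h‖ ≤ m * (1 / 2) ^ n := by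
    intro n k h hh
    refine norm_le_of_homogeneous (h₁ := h₁) (hTd n k) (taylorTerm_smul (P n) p k) (fun h' hh' => ?_) hh
    rcases (hsub hh').2 with h2 | h2
    · rw [one_div, inv_pow, ← div_eq_mul_inv, le_div_iff₀ (by positivity)]
      exact h2 n k
    · exact absurd (hsub hh').1 h2
  -- The bound at `2 • h` gives the factor `2⁻¹ ^ k` in the bound at `h`, so the sum over `k` converges.
  refine ⟨min (ρ / 2) r, by positivity, (min_le_right _ _).trans (by rw [hr]; linarith), 2 * m,
    fun n x hx => ?_⟩
  rw [mem_ball, dist_eq_norm, lt_min_iff] at hx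
  have hx2 : (2 : ℂ) • (x - p) ∈ ball (0 : Z) ρ := by
    rw [mem_ball_zero_iff, norm_smul, Complex.norm_ofNat]
    linarith
  have hsum := hasSum_taylorTerm (hP n) (p := p) (h := x - p) (r := 5) (by norm_num)
    fun ζ hζ => hline _ (by simpa using hx.2) ζ (by simpa using hζ)
  rw [add_sub_cancel] at hsum
  have hgeo : HasSum (fun k : ℕ => m * (1 / 2 : ℝ) ^ n * (1 / 2) ^ k) (m * (1 / 2 : ℝ) ^ n * 2) :=
    hasSum_geometric_two.mul_left _
  rw [← hsum.tsum_eq]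
  refine (tsum_of_norm_bounded hgeo fun k => ?_).trans_eq (by ring)
  have h3 := hT n k _ hx2
  rw [taylorTerm_smul, norm_mul, norm_pow, Complex.norm_ofNat] at h3
  rw [one_div (2 : ℝ), inv_pow 2 k, ← div_eq_mul_inv, le_div_iff₀ (by positivity), ← one_div,
    mul_comm]
  exact h3

/-- The sum of a series of holomorphic functions bounded by a convergent series is holomorphic. -/
theorem differentiableAt_tsum_of_norm_le {P : ℕ → Z → ℂ} {p : Z} {ρ : ℝ} {u : ℕ → ℝ} (hρ : 0 < ρ)
    (hu : Summable u) (hP : ∀ n, DifferentiableOn ℂ (P n) (ball p ρ))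
    (hbound : ∀ n, ∀ x ∈ ball p ρ, ‖P n x‖ ≤ u n) :
    DifferentiableAt ℂ (fun x => ∑' n, P n x) p := by
  refine differentiableAt_of_gateaux hρ (M := ∑' n, u n)
    (fun x hx => tsum_of_norm_bounded hu.hasSum fun n => hbound n x hx) fun x hx v => ?_
  have hs : IsOpen {t : ℂ | x + t • v ∈ ball p ρ} := isOpen_ball.preimage (by fun_prop)
  have h1 : DifferentiableOn ℂ (fun t : ℂ => ∑' n, P n (x + t • v)) {t : ℂ | x + t • v ∈ ball p ρ} :=
    Complex.differentiableOn_tsum_of_summable_norm hu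
      (fun n => (hP n).comp (by fun_prop) fun t ht => ht) hs fun n t ht => hbound n _ ht
  exact h1.differentiableAt (hs.mem_nhds (by simpa using hx))

end Series

section Extension

theorem RHolomorphicOn.differentiableOn {Z : Type*} [NormedAddCommGroup Z] [NormedSpace ℂ Z]
    {f : Z → ℂ} {D : Set Z} (hD : IsOpen D) (hf : RHolomorphicOn f D) :
    DifferentiableOn ℂ f D := by
  intro p hp
  obtain ⟨β, hβ, hsub⟩ := Metric.nhds_basis_closedBall.mem_iff.1 (hD.mem_nhds hp)
  obtain ⟨M, hM⟩ := hf.1 p β hβ hsub (β / 2) (by positivity) (by linarith)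
  refine (differentiableAt_of_gateaux (ρ := β / 2) (M := M) (by positivity)
    (fun x hx => hM x (ball_subset_closedBall hx)) fun x hx v => ?_).differentiableWithinAt
  refine (hf.2 x (hsub ?_) v).differentiableAt
  exact closedBall_subset_closedBall (by linarith) (ball_subset_closedBall hx)

theorem BoundedOnBalls.exists_bound {X Y : Type*} [NormedAddCommGroup X] [NormedAddCommGroup Y]
    {f : X × Y → ℂ} (hf : BoundedOnBalls f (ball (0 : X) 1 ×ˢ ball (0 : Y) 1)) :
    ∃ C : ℝ → ℝ, ∀ s, 1 / 2 ≤ s → s < 1 →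
      ∀ z ∈ closedBall (0 : X) s, ∀ w ∈ closedBall (0 : Y) s, ‖f (z, w)‖ ≤ C s := by
  have : ∀ s : ℝ, ∃ M : ℝ, 1 / 2 ≤ s → s < 1 →
      ∀ z ∈ closedBall (0 : X) s, ∀ w ∈ closedBall (0 : Y) s, ‖f (z, w)‖ ≤ M := by
    intro s
    by_cases hs : 1 / 2 ≤ s ∧ s < 1
    · obtain ⟨M, hM⟩ := hf 0 ((1 + s) / 2) (by linarith) (by
        rw [← Prod.mk_zero_zero, ← closedBall_prod_same]
        exact Set.prod_mono (closedBall_subset_ball (by linarith))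
          (closedBall_subset_ball (by linarith))) s (by linarith) (by linarith)
      refine ⟨M, fun _ _ z hz w hw => hM _ ?_⟩
      rw [← Prod.mk_zero_zero, ← closedBall_prod_same]
      exact ⟨hz, hw⟩
    · exact ⟨0, fun h1 h2 => absurd ⟨h1, h2⟩ hs⟩
  choose C hC using this
  exact ⟨C, hC⟩

variable {X Y : Type*} [NormedAddCommGroup X] [NormedSpace ℂ X] [NormedAddCommGroup Y]
  [NormedSpace ℂ Y]

/-- The homogeneous part of degree `n` of the Taylor expansion of `f (z, ·)` about `0`, as a
function of the pair `(z, w)`. -/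
noncomputable def partialTaylorTerm (f : X × Y → ℂ) (n : ℕ) (p : X × Y) : ℂ :=
  taylorTerm f (p.1, 0) n (0, p.2)

variable {f : X × Y → ℂ}

theorem mem_prod_ball_of_norm_lt {z : X} {w : Y} {ζ : ℂ} (hz : ‖z‖ < 1) (hw : ‖ζ‖ * ‖w‖ < 1) :
    (z, (0 : Y)) + ζ • ((0 : X), w) ∈ ball (0 : X) 1 ×ˢ ball (0 : Y) 1 := by
  constructor
  · simpa using hz
  · simpa [norm_smul] using hw

theorem differentiableOn_partialTaylorTerm
    (hf : DifferentiableOn ℂ f (ball (0 : X) 1 ×ˢ ball (0 : Y) 1)) (n : ℕ) :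
    DifferentiableOn ℂ (partialTaylorTerm f n) (ball (0 : X) 1 ×ˢ Set.univ) := by
  refine (differentiableOn_taylorTerm (isOpen_ball.prod isOpen_ball) hf n).comp
    (f := fun p : X × Y => ((p.1, (0 : Y)), ((0 : X), p.2))) (by fun_prop) fun p hp => ?_
  exact ⟨⟨hp.1, mem_ball_self one_pos⟩, trivial⟩

theorem hasSum_partialTaylorTerm
    (hf : DifferentiableOn ℂ f (ball (0 : X) 1 ×ˢ ball (0 : Y) 1)) {p : X × Y}
    (hp : p ∈ ball (0 : X) 1 ×ˢ ball (0 : Y) 1) :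
    HasSum (fun n => partialTaylorTerm f n p) (f p) := by
  obtain ⟨z, w⟩ := p
  have hz : ‖z‖ < 1 := by simpa using hp.1
  have hw : ‖w‖ < 1 := by simpa using hp.2
  have hw0 := norm_nonneg w
  have h1 := hasSum_taylorTerm hf (p := (z, 0)) (h := (0, w)) (r := 2 / (1 + ‖w‖))
    (by rw [one_lt_div (by positivity)]; linarith) fun ζ hζ => by
      refine mem_prod_ball_of_norm_lt hz ?_
      rw [lt_div_iff₀ (by positivity)] at hζ
      nlinarith [norm_nonneg ζ]
  simpa [partialTaylorTerm] using h1

theorem norm_partialTaylorTerm_le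
    (hf : DifferentiableOn ℂ f (ball (0 : X) 1 ×ˢ ball (0 : Y) 1)) {C : ℝ → ℝ}
    (hC : ∀ s, 1 / 2 ≤ s → s < 1 →
      ∀ z ∈ closedBall (0 : X) s, ∀ w ∈ closedBall (0 : Y) s, ‖f (z, w)‖ ≤ C s)
    {A : ℝ} (hA : 0 < A) {w : Y} (hw : 2 * ‖w‖ ≤ A) {s : ℝ} (hs : 1 / 2 ≤ s) (hs1 : s < 1) (n : ℕ)
    {z : X} (hz : z ∈ closedBall (0 : X) s) :
    ‖partialTaylorTerm f n (z, w)‖ ≤ C s * A ^ n := by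
  have hζw : ∀ ζ : ℂ, ‖ζ‖ ≤ A⁻¹ → ‖ζ‖ * ‖w‖ ≤ 1 / 2 := by
    intro ζ hζ
    calc ‖ζ‖ * ‖w‖ ≤ A⁻¹ * (A / 2) := by gcongr; linarith
      _ = 1 / 2 := by field_simp
  have h1 := norm_taylorTerm_le hf (p := (z, 0)) (h := (0, w)) (r := A⁻¹) (M := C s)
    (by positivity)
    (fun ζ hζ => mem_prod_ball_of_norm_lt ((mem_closedBall_zero_iff.1 hz).trans_lt hs1)
      ((hζw ζ hζ).trans_lt (by norm_num)))
    (fun ζ hζ => by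
      have h2 := hC s hs hs1 z hz (ζ • w) (by
        rw [mem_closedBall_zero_iff, norm_smul]; exact (hζw ζ hζ).trans hs)
      simpa using h2) n
  rwa [inv_pow, div_inv_eq_mul] at h1

/-- If `f (z, ·)` extends to an entire function, its Taylor terms decay super-geometrically. -/
theorem superGeometric_partialTaylorTerm_of_extends {z : X} {g : Y → ℂ} (hg : Differentiable ℂ g)
    (hgf : ∀ w ∈ ball (0 : Y) 1, g w = f (z, w)) (w : Y) :
    SuperGeometric fun n => ‖partialTaylorTerm f n (z, w)‖ := by
  intro R hR
  have heq : ∀ n, partialTaylorTerm f n (z, w) = taylorTerm g 0 n w := by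
    intro n
    rw [partialTaylorTerm, taylorTerm, taylorTerm]
    congr 1
    refine Filter.EventuallyEq.iteratedDeriv_eq n ?_
    have hc : Tendsto (fun ζ : ℂ => ζ • w) (𝓝 0) (𝓝 ((0 : ℂ) • w)) :=
      (continuous_id.smul continuous_const).tendsto 0
    rw [zero_smul] at hc
    filter_upwards [hc (ball_mem_nhds (0 : Y) one_pos)] with ζ hζ
    simp [hgf _ hζ]
  have hcont : Continuous fun ζ : ℂ => g (0 + ζ • w) := hg.continuous.comp (by fun_prop)
  obtain ⟨M, hM⟩ := (isCompact_closedBall (0 : ℂ) R).exists_bound_of_continuousOn hcont.continuousOn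
  refine ⟨M, fun n => ?_⟩
  have h1 := norm_taylorTerm_le (U := Set.univ) hg.differentiableOn (p := 0) (h := w) hR
    (fun _ _ => trivial) (fun ζ hζ => hM ζ (by simpa using hζ)) n
  rwa [le_div_iff₀ (by positivity), ← heq] at h1

/-- The extension theorem for arbitrary Banach spaces: the extension is the sum of the Taylor series
in the second variable. -/
theorem exists_extension_of_plurithick [CompleteSpace X] [CompleteSpace Y]
    (hf : RHolomorphicOn f (ball (0 : X) 1 ×ˢ ball (0 : Y) 1)) {E : Set X}
    (hE : Plurithick E (ball (0 : X) 1))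
    (hext : ∀ z ∈ E, ∃ g : Y → ℂ, Differentiable ℂ g ∧ ∀ w ∈ ball (0 : Y) 1, g w = f (z, w)) :
    ∃ F : X × Y → ℂ, DifferentiableOn ℂ F (ball (0 : X) 1 ×ˢ (Set.univ : Set Y)) ∧
      ∀ p ∈ ball (0 : X) 1 ×ˢ ball (0 : Y) 1, F p = f p := by
  have hd := hf.differentiableOn (isOpen_ball.prod isOpen_ball)
  have hPd := differentiableOn_partialTaylorTerm hd
  obtain ⟨C, hC⟩ := hf.1.exists_bound
  have hdecay : ∀ (w : Y), ∀ z ∈ ball (0 : X) 1,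
      SuperGeometric fun n => ‖partialTaylorTerm f n (z, w)‖ := by
    intro w z hz
    have hA : 1 ≤ 2 * ‖w‖ + 1 := by linarith [norm_nonneg w]
    refine hE.superGeometric_ball (φ := fun n z => partialTaylorTerm f n (z, w)) (C := C)
      (A := 2 * ‖w‖ + 1) (fun n => (hPd n).comp (by fun_prop) fun z hz => ⟨hz, trivial⟩) hA
      (fun s hs hs1 n z hz => norm_partialTaylorTerm_le hd hC (by linarith) (by linarith) hs hs1 n hz)
      (fun z hz => ?_) hz
    obtain ⟨g, hg, hgf⟩ := hext z hz
    exact superGeometric_partialTaylorTerm_of_extends hg hgf w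
  refine ⟨fun p => ∑' n, partialTaylorTerm f n p, fun p hp => ?_,
    fun p hp => (hasSum_partialTaylorTerm hd hp).tsum_eq⟩
  refine DifferentiableAt.differentiableWithinAt ?_
  obtain ⟨z₀, w₀⟩ := p
  have hz₀ : ‖z₀‖ < 1 := by simpa using hp.1
  have hz₀' := norm_nonneg z₀
  set ρ₀ : ℝ := (1 - ‖z₀‖) / 2 with hρ₀
  set s : ℝ := (1 + ‖z₀‖) / 2 with hs
  have hsub : ∀ x ∈ ball (z₀, w₀) ρ₀, x.1 ∈ closedBall (0 : X) s ∧ 2 * ‖x.2‖ ≤ 2 * (‖w₀‖ + 1) := by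
    intro x hx
    rw [← ball_prod_same] at hx
    have h1 : ‖x.1 - z₀‖ < ρ₀ := by simpa [dist_eq_norm] using hx.1
    have h2 : ‖x.2 - w₀‖ < ρ₀ := by simpa [dist_eq_norm] using hx.2
    have h3 := norm_le_norm_add_norm_sub' x.1 z₀
    have h4 := norm_le_norm_add_norm_sub' x.2 w₀
    rw [mem_closedBall_zero_iff]
    constructor <;> linarith
  have hs1 : s < 1 := by linarith
  have hball : ball (z₀, w₀) ρ₀ ⊆ ball (0 : X) 1 ×ˢ Set.univ := fun x hx =>
    ⟨closedBall_subset_ball hs1 (hsub x hx).1, trivial⟩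
  have hw₀ := norm_nonneg w₀
  obtain ⟨ρ, hρ, hρle, M, hM⟩ := exists_ball_norm_le_geometric (P := partialTaylorTerm f)
    (p := (z₀, w₀)) (ρ₀ := ρ₀) (C := max (C s) 1) (K := 2 * (‖w₀‖ + 1)) (by linarith)
    (le_max_right _ _) (by linarith) (fun n => (hPd n).mono hball)
    (fun n x hx => (norm_partialTaylorTerm_le hd hC (by linarith) (hsub x hx).2 (by linarith) hs1 n
      (hsub x hx).1).trans (by gcongr; exact le_max_left _ _))
    (fun x hx => hdecay x.2 x.1 (hball hx).1)
  exact differentiableAt_tsum_of_norm_le hρ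
    ((summable_geometric_of_lt_one (by norm_num) (by norm_num)).mul_left M)
    (fun n => (hPd n).mono ((ball_subset_ball hρle).trans hball)) hM

end Extension

theorem mainTheorem3 (r₁ r₂ : Polyradius) (f : SeqSpace r₁ × SeqSpace r₂ → ℂ)
    (hf : RHolomorphicOn f (ball (0 : SeqSpace r₁) 1 ×ˢ ball (0 : SeqSpace r₂) 1))
    (E : Set (SeqSpace r₁)) (hE : Plurithick E (ball (0 : SeqSpace r₁) 1))
    (hext : ∀ z ∈ E, ∃ g : SeqSpace r₂ → ℂ, Differentiable ℂ g ∧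
      ∀ w ∈ ball (0 : SeqSpace r₂) 1, g w = f (z, w)) :
    ∃ F : SeqSpace r₁ × SeqSpace r₂ → ℂ,
      DifferentiableOn ℂ F (ball (0 : SeqSpace r₁) 1 ×ˢ (Set.univ : Set (SeqSpace r₂))) ∧
      ∀ p ∈ ball (0 : SeqSpace r₁) 1 ×ˢ ball (0 : SeqSpace r₂) 1, F p = f p :=
  exists_extension_of_plurithick hf hE hext
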